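/- **Setting.** Let $\mathcal D$ be the set of càdlàg functions $x:[0,\infty)\to\mathbb R$, with the Skorokhod $J_1$ topology: $\alpha_n\to\alpha$ in $\mathcal D$ iff there are increasing bijections $\lambda_n$ of $[0,\infty)$ with $\sup_s|\lambda_n(s)-s|\to0$ and $\sup_{s\le N}|\alpha_n(\lambda_n(s))-\alpha(s)|\to0$ for every $N$. Put $\Delta x(t)=x(t)-x(t-)$ for $t>0$ and $\Delta x(0)=0$. Let $\pi=(\pi_n)$ be a sequence of finite partitions $\pi_n=(0=t^n_0<t^n_1<\dots<t^n_{k_n}<\infty)$ with $t^n_{k_n}\to\infty$ and $\max_{i<k_n}|t^n_{i+1}\wedge T-t^n_i\wedge T|\to0$ for every $T$. For $x\in\mathcal D$ and $t\ge0$ let $$\mu_n=\sum_{i<k_n}\bigl(x(t^n_{i+1})-x(t^n_i)\bigr)^2\delta_{t^n_i},\qquad s_n(t)=\sum_{i<k_n}\bigl|x(t^n_{i+1}\wedge t)-x(t^n_i\wedge t)\bigr|^2,\qquad q_n(t)=\sum_{i<k_n,\;t^n_i\le t}\bigl(x(t^n_{i+1})-x(t^n_i)\bigr)^2 .$$ A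 function $v:[0,\infty)\to\mathbb R$ *has the Lebesgue decomposition* (with respect to $x$) if $v(t)=v^c(t)+\sum_{s\le t}(\Delta x(s))^2$ for all $t\ge0$, where the sums are finite and $v^c$ is continuous and nondecreasing with $v^c(0)=0$. - $\mathcal Q_0^\pi$ is the set of $x\in\mathcal D$ that have finite quadratic variation $[x]_\pi$ along $\pi$ in the sense of Föllmer: $\mu_n$ converges vaguely to a Radon measure $\mu$ on $[0,\infty)$ such that $[x]_\pi(t):=\mu([0,t])$ has the Lebesgue decomposition. - $\mathcal Q_1^\pi$ is the set of $x\in\mathcal D$ for which $s_n$ converges pointwise on $[0,\infty)$ to a function $s$ that has the Lebesgue decomposition. - $\mathcal Q_2^\pi$ is the set of $x\in\mathcal D$ for which $q_n$ converges pointwise on $[0,\infty)$ to a function $q$ that has the Lebesgue decomposition. - $\mathcal Q^\pi$ is the set of $x\in\mathcal D$ for which $q_n$ converges in $\mathcal D$ with the $J_1$ topology to some $\tilde q\in\mathcal D$. **Theorem 2.7.** 1. $\mathcal Q_0^\pi=\mathcal Q_1^\pi=\mathcal Q_2^\pi=\mathcal Q^\pi$. 2. If $x\in\mathcal Q_0^\pi$,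 then all four limits exist, are unique, and coincide: $[x]_\pi=s=q=\tilde q$. 3. $x\in\mathcal D$ has finite quadratic variation along $\pi$ if and only if $q_n$ converges in $\mathcal D$ with the $J_1$ topology. 4. If $q_n$ converges in $\mathcal D$ with the $J_1$ topology, then its limit is $[x]_\pi$ (so it has the Lebesgue decomposition). -/

import Mathlib

open Filter Topology MeasureTheory
open scoped NNReal

namespace PathwiseQV

/-- Right-continuous with left limits, for real functions on `[0,∞)`.
(At `t = 0` the filter `𝓝[<] 0` is trivial, so only right-continuity is required there.) -/
def IsCadlag (f : ℝ≥0 → ℝ) : Prop :=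
  ∀ t : ℝ≥0, ContinuousWithinAt f (Set.Ici t) t ∧ ∃ l : ℝ, Tendsto f (𝓝[<] t) (𝓝 l)

/-- The space `𝒟 = 𝒟([0,∞), ℝ)` of real càdlàg functions. -/
@[ext]
structure CadlagPath where
  /-- the underlying function -/
  toFun : ℝ≥0 → ℝ
  isCadlag : IsCadlag toFun

instance : CoeFun CadlagPath (fun _ => ℝ≥0 → ℝ) := ⟨CadlagPath.toFun⟩

/-- The jump `Δx(t) = x(t) - x(t-)`, with `x(0-) = x(0)`, i.e. `Δx(0) = 0`. -/
noncomputable def CadlagPath.jump (x : CadlagPath) (t : ℝ≥0) : ℝ :=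
  x t - Function.leftLim x.toFun t

/-- Convergence of a sequence in `𝒟` for the Skorokhod `J₁` topology on `[0,∞)`: there are
time changes `lam n` (increasing bijections of `[0,∞)`) with
`sup_s |lam n s - s| → 0` and `sup_{s ≤ N} |a n (lam n s) - b s| → 0` for every `N`. -/
def TendstoJ1 (a : ℕ → CadlagPath) (b : CadlagPath) : Prop :=
  ∃ lam : ℕ → (ℝ≥0 ≃o ℝ≥0),
    TendstoUniformly (fun n s => lam n s) (fun s => s) atTop ∧
    ∀ N : ℝ≥0, TendstoUniformlyOn (fun n s => a n (lam n s)) b atTop (Set.Iic N)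

/-- A finite partition `0 = t 0 < t 1 < ⋯ < t k < ∞` (only the values `t i`, `i ≤ k`, matter). -/
structure TimePartition where
  /-- the index of the last partition point -/
  k : ℕ
  /-- the partition points -/
  t : ℕ → ℝ≥0
  t_zero : t 0 = 0
  strictMonoOn : StrictMonoOn t (Set.Iic k)

namespace TimePartition

/-- The mesh on `[0,T]`: the largest length of an interval `[t i, t (i+1)] ∩ [0,T]`. -/
noncomputable def mesh (p : TimePartition) (T : ℝ≥0) : ℝ≥0 :=
  (Finset.range p.k).sup fun i => min (p.t (i + 1)) T - min (p.t i) T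

/-- The discrete measure `μ = ∑ (x(t_{i+1}) - x(t_i))² δ_{t_i}`. In this and in the following sums
the last point `t k` does not contribute, its successor being `t k` itself by convention. -/
noncomputable def measure (p : TimePartition) (x : CadlagPath) : Measure ℝ≥0 :=
  ∑ i ∈ Finset.range p.k,
    ENNReal.ofReal ((x (p.t (i + 1)) - x (p.t i)) ^ 2) • Measure.dirac (p.t i)

/-- The sums `s(t) = ∑ |x(t_{i+1} ∧ t) - x(t_i ∧ t)|²`. -/
noncomputable def sSum (p : TimePartition) (x : CadlagPath) (t : ℝ≥0) : ℝ :=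
  ∑ i ∈ Finset.range p.k, |x (min (p.t (i + 1)) t) - x (min (p.t i) t)| ^ 2

/-- The sums `q(t) = ∑_{t_i ≤ t} (x(t_{i+1}) - x(t_i))²`. -/
noncomputable def qSum (p : TimePartition) (x : CadlagPath) (t : ℝ≥0) : ℝ :=
  ∑ i ∈ (Finset.range p.k).filter (fun i => p.t i ≤ t), (x (p.t (i + 1)) - x (p.t i)) ^ 2

end TimePartition

theorem isCadlag_step (u : ℝ≥0) (a : ℝ) : IsCadlag (fun t => if u ≤ t then a else 0) := by
  intro t
  constructor
  · by_cases h : u ≤ t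
    · refine (continuousWithinAt_const (b := a)).congr (fun s hs => ?_) ?_
      · exact if_pos (h.trans hs)
      · exact if_pos h
    · refine ContinuousAt.continuousWithinAt ?_
      refine (continuousAt_const (y := (0 : ℝ))).congr ?_
      filter_upwards [Iio_mem_nhds (not_le.mp h)] with s hs
      exact (if_neg (not_le.mpr hs)).symm
  · by_cases h : u < t
    · refine ⟨a, tendsto_const_nhds.congr' ?_⟩
      filter_upwards [mem_nhdsWithin_of_mem_nhds (Ioi_mem_nhds h)] with s hs
      exact (if_pos (le_of_lt hs)).symm
    · refine ⟨0, tendsto_const_nhds.congr' ?_⟩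
      filter_upwards [self_mem_nhdsWithin] with s hs
      exact (if_neg (not_le.mpr (lt_of_lt_of_le hs (not_lt.mp h)))).symm

theorem IsCadlag.sum {ι : Type*} (s : Finset ι) (f : ι → ℝ≥0 → ℝ) (hf : ∀ i ∈ s, IsCadlag (f i)) :
    IsCadlag (fun t => ∑ i ∈ s, f i t) := by
  intro t
  refine ⟨tendsto_finsetSum s fun i hi => (hf i hi t).1, ?_⟩
  choose! l hl using fun i (hi : i ∈ s) => (hf i hi t).2
  exact ⟨∑ i ∈ s, l i, tendsto_finsetSum s hl⟩

theorem TimePartition.isCadlag_qSum (p : TimePartition) (x : CadlagPath) :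
    IsCadlag (p.qSum x) := by
  have h : p.qSum x = fun t => ∑ i ∈ Finset.range p.k,
      if p.t i ≤ t then (x (p.t (i + 1)) - x (p.t i)) ^ 2 else 0 := by
    funext t
    simp only [TimePartition.qSum, Finset.sum_filter]
  rw [h]
  exact IsCadlag.sum _ _ fun i _ => isCadlag_step _ _

/-- The function `q` as an element of `𝒟`. -/
noncomputable def TimePartition.qPath (p : TimePartition) (x : CadlagPath) : CadlagPath :=
  ⟨p.qSum x, p.isCadlag_qSum x⟩

/-- Sequences of partitions of `[0,∞)`: the last points tend to `∞` and the mesh tends to `0`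
on compacts. -/
structure IsPartitionSequence (π : ℕ → TimePartition) : Prop where
  tendsto_last : Tendsto (fun n => (π n).t (π n).k) atTop atTop
  tendsto_mesh : ∀ T : ℝ≥0, Tendsto (fun n => (π n).mesh T) atTop (𝓝 0)

/-- Vague convergence of measures on `[0,∞)`: tested on continuous functions with compact support. -/
def TendstoVaguely (m : ℕ → Measure ℝ≥0) (μ : Measure ℝ≥0) : Prop :=
  ∀ f : ℝ≥0 → ℝ, Continuous f → HasCompactSupport f →
    Tendsto (fun n => ∫ t, f t ∂(m n)) atTop (𝓝 (∫ t, f t ∂μ))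

/-- The Lebesgue decomposition `v(t) = c(t) + ∑_{s ≤ t} (Δx(s))²` with `c` continuous and
increasing. Continuity is understood with the convention `c(0-) = 0`, i.e. `c(0) = 0`: the jumps
of `v` (an atom at `0` included) are exactly the squared jumps of `x`. -/
def HasLebesgueDecomposition (x : CadlagPath) (v : ℝ≥0 → ℝ) : Prop :=
  ∃ c : ℝ≥0 → ℝ, Continuous c ∧ Monotone c ∧ c 0 = 0 ∧
    ∀ t : ℝ≥0, Summable (fun s : Set.Iic t => x.jump s ^ 2) ∧
      v t = c t + ∑' s : Set.Iic t, x.jump s ^ 2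

/-- `v` is the quadratic variation `[x]_π` of `x` along `π` in the sense of Föllmer. -/
def IsQuadraticVariation (π : ℕ → TimePartition) (x : CadlagPath) (v : ℝ≥0 → ℝ) : Prop :=
  ∃ μ : Measure ℝ≥0, μ.Regular ∧ TendstoVaguely (fun n => (π n).measure x) μ ∧
    (∀ t : ℝ≥0, v t = μ.real (Set.Icc 0 t)) ∧ HasLebesgueDecomposition x v

/-- `s` is the pointwise limit of the sums `s_n`. -/
def IsLimitS (π : ℕ → TimePartition) (x : CadlagPath) (s : ℝ≥0 → ℝ) : Prop :=
  ∀ t : ℝ≥0, Tendsto (fun n => (π n).sSum x t) atTop (𝓝 (s t))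

/-- `q` is the pointwise limit of the sums `q_n`. -/
def IsLimitQ (π : ℕ → TimePartition) (x : CadlagPath) (q : ℝ≥0 → ℝ) : Prop :=
  ∀ t : ℝ≥0, Tendsto (fun n => (π n).qSum x t) atTop (𝓝 (q t))

/-- `q` is the limit of `q_n` in `𝒟` with the Skorokhod `J₁` topology. -/
def IsLimitJ1 (π : ℕ → TimePartition) (x : CadlagPath) (q : CadlagPath) : Prop :=
  TendstoJ1 (fun n => (π n).qPath x) q

/-- Paths with (finite) quadratic variation along `π` in the sense of Föllmer. -/
def Q₀ (π : ℕ → TimePartition) : Set CadlagPath :=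
  {x | ∃ v : ℝ≥0 → ℝ, IsQuadraticVariation π x v}

/-- Paths for which `s_n` has a pointwise limit with Lebesgue decomposition. -/
def Q₁ (π : ℕ → TimePartition) : Set CadlagPath :=
  {x | ∃ s : ℝ≥0 → ℝ, IsLimitS π x s ∧ HasLebesgueDecomposition x s}

/-- Paths for which `q_n` has a pointwise limit with Lebesgue decomposition. -/
def Q₂ (π : ℕ → TimePartition) : Set CadlagPath :=
  {x | ∃ q : ℝ≥0 → ℝ, IsLimitQ π x q ∧ HasLebesgueDecomposition x q}

/-- Paths for which `q_n` converges in the Skorokhod `J₁` topology. -/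
def QJ1 (π : ℕ → TimePartition) : Set CadlagPath :=
  {x | ∃ q : CadlagPath, IsLimitJ1 π x q}

end PathwiseQV

/-! Everything is reduced to one condition: `q_n → v` pointwise and `v` has the Lebesgue
decomposition. By `hasLebesgueDecomposition_iff`, the latter says that `v` is increasing,
right-continuous, zero at `0`, with left limits `v t - (Δx t)²`.

The sums `s_n(t)` and `q_n(t)` differ only on the partition interval containing `t`, and
right-continuity of `x` makes the difference vanish (`tendsto_sSum_sub_qSum`).

Both vague and `J₁` convergence control `q_n` at `t` only up to a small shift of time. From above
this suffices, as `v` is right-continuous. From below it yields only `v(t-)`; the missing `(Δx t)²`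
is supplied by the increment over the interval `t_j < t ≤ t_{j+1}`, which `q_n(t)` already counts
(`eventually_lt_partialSum`). Conversely, pointwise convergence of distribution functions gives
vague convergence by step approximation.

A `J₁` limit has the decomposition automatically: a jump of the limit forces `q_n` to jump at the
matched time, hence by a single squared increment, over an interval that must straddle the jump time
(`jump_eq_sq_jump_of_pos`). Conversely, given pointwise convergence, a time change carries finitely
many times to partition points where `q_n` makes the corresponding jumps; monotonicity controls the
rest (`eventually_exists_timeChange`). -/

namespace PathwiseQV

/-! ### Sums of jumps and the Lebesgue decomposition. -/

section JumpSum

variable {f : ℝ≥0 → ℝ} {v : ℝ≥0 → ℝ}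

theorem tsum_Iic_eq_indicator (f : ℝ≥0 → ℝ) (t : ℝ≥0) :
    ∑' s : Set.Iic t, f s = ∑' s, (Set.Iic t).indicator f s :=
  tsum_subtype _ _

theorem summable_indicator_Iic (hf : ∀ t : ℝ≥0, Summable (fun s : Set.Iic t => f s)) (t : ℝ≥0) :
    Summable ((Set.Iic t).indicator f) :=
  summable_subtype_iff_indicator.mp (hf t)

theorem tsum_Iic_sub_tsum_Iic (hf : ∀ t : ℝ≥0, Summable (fun s : Set.Iic t => f s))
    {r t : ℝ≥0} (hrt : r ≤ t) :
    ∑' s : Set.Iic t, f s - ∑' s : Set.Iic r, f s = ∑' s, (Set.Ioc r t).indicator f s := by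
  rw [tsum_Iic_eq_indicator, tsum_Iic_eq_indicator,
    ← (summable_indicator_Iic hf t).tsum_sub (summable_indicator_Iic hf r)]
  refine tsum_congr fun s => ?_
  by_cases h1 : s ≤ r
  · simp [Set.indicator, h1, h1.trans hrt, not_lt.mpr h1]
  · by_cases h2 : s ≤ t <;> simp [Set.indicator, h1, h2, not_le.mp h1]

theorem tsum_Iic_mono (h0 : ∀ s, 0 ≤ f s) (hf : ∀ t : ℝ≥0, Summable (fun s : Set.Iic t => f s)) :
    Monotone fun t : ℝ≥0 => ∑' s : Set.Iic t, f s := by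
  intro r t hrt
  have := tsum_Iic_sub_tsum_Iic hf hrt
  have h2 : 0 ≤ ∑' s, (Set.Ioc r t).indicator f s :=
    tsum_nonneg fun s => Set.indicator_nonneg (fun s _ => h0 s) s
  simp only
  linarith

theorem tsum_Iic_rightCont (h0 : ∀ s, 0 ≤ f s)
    (hf : ∀ t : ℝ≥0, Summable (fun s : Set.Iic t => f s)) (t : ℝ≥0) :
    ContinuousWithinAt (fun t : ℝ≥0 => ∑' s : Set.Iic t, f s) (Set.Ici t) t := by
  have heq : (fun t : ℝ≥0 => ∑' s : Set.Iic t, f s) =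
      fun t : ℝ≥0 => ∑' s, (Set.Iic t).indicator f s := funext (tsum_Iic_eq_indicator f)
  rw [heq]
  refine tendsto_tsum_of_dominated_convergence (summable_indicator_Iic hf (t + 1)) ?_ ?_
  · intro s
    refine tendsto_const_nhds.congr' ?_
    by_cases h : s ≤ t
    · filter_upwards [self_mem_nhdsWithin] with r hr
      simp [Set.indicator, h, h.trans hr]
    · filter_upwards [mem_nhdsWithin_of_mem_nhds (Iio_mem_nhds (not_le.mp h))] with r hr
      simp [Set.indicator, h, not_le.mpr (Set.mem_Iio.mp hr)]
  · filter_upwards [mem_nhdsWithin_of_mem_nhds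
      (Iio_mem_nhds (show t < t + 1 from lt_add_one t))] with r hr s
    rw [Real.norm_of_nonneg (Set.indicator_nonneg (fun s _ => h0 s) s)]
    exact Set.indicator_le_indicator_of_subset (Set.Iic_subset_Iic.mpr (le_of_lt hr)) h0 s

theorem tsum_Iic_leftLim (h0 : ∀ s, 0 ≤ f s)
    (hf : ∀ t : ℝ≥0, Summable (fun s : Set.Iic t => f s)) (t : ℝ≥0) :
    Tendsto (fun t : ℝ≥0 => ∑' s : Set.Iic t, f s) (𝓝[<] t)
      (𝓝 (∑' s : Set.Iic t, f s - f t)) := by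
  have heq : (fun t : ℝ≥0 => ∑' s : Set.Iic t, f s) =
      fun t : ℝ≥0 => ∑' s, (Set.Iic t).indicator f s := funext (tsum_Iic_eq_indicator f)
  have hlim : ∑' s : Set.Iic t, f s - f t = ∑' s, (Set.Iio t).indicator f s := by
    have h1 : f t = ∑' s, ({t} : Set ℝ≥0).indicator f s := by
      rw [tsum_eq_single t (fun s hs => by simp [hs])]
      simp
    have h2 : Summable (({t} : Set ℝ≥0).indicator f) :=
      summable_of_ne_finset_zero (s := {t}) fun s hs => by
        rw [Finset.mem_singleton] at hs; simp [Set.indicator, hs]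
    rw [tsum_Iic_eq_indicator, h1, ← (summable_indicator_Iic hf t).tsum_sub h2]
    refine tsum_congr fun s => ?_
    rcases lt_trichotomy s t with h | h | h
    · simp [Set.indicator, h, h.le, h.ne]
    · simp [Set.indicator, h]
    · simp [Set.indicator, not_le.mpr h, not_lt.mpr h.le, h.ne']
  rw [heq, hlim]
  refine tendsto_tsum_of_dominated_convergence (summable_indicator_Iic hf t) ?_ ?_
  · intro s
    refine tendsto_const_nhds.congr' ?_
    by_cases h : s < t
    · filter_upwards [mem_nhdsWithin_of_mem_nhds (Ioi_mem_nhds h)] with r hr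
      simp [Set.indicator, h, le_of_lt (Set.mem_Ioi.mp hr)]
    · filter_upwards [self_mem_nhdsWithin] with r hr
      have : ¬ s ≤ r := not_le.mpr (lt_of_lt_of_le hr (not_lt.mp h))
      simp [Set.indicator, h, this]
  · filter_upwards [self_mem_nhdsWithin] with r hr s
    rw [Real.norm_of_nonneg (Set.indicator_nonneg (fun s _ => h0 s) s)]
    exact Set.indicator_le_indicator_of_subset (Set.Iic_subset_Iic.mpr (le_of_lt hr)) h0 s

/-- The jumps of an increasing function in `(r, t]` add up to at most its increment. -/
theorem Monotone.sum_jumps_le (hv : Monotone v)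
    (hl : ∀ t, 0 < t → Tendsto v (𝓝[<] t) (𝓝 (v t - f t))) (F : Finset ℝ≥0) :
    ∀ r t : ℝ≥0, r ≤ t → (∀ s ∈ F, r < s ∧ s ≤ t) → ∑ s ∈ F, f s ≤ v t - v r := by
  induction F using Finset.induction_on_max with
  | empty => intro r t hrt _; simpa using hv hrt
  | insert a F ha ih =>
    intro r t hrt hF
    obtain ⟨hra, hat⟩ := hF a (Finset.mem_insert_self _ _)
    have ha0 : 0 < a := lt_of_le_of_lt (zero_le) hra
    rw [Finset.sum_insert fun h => lt_irrefl a (ha a h)]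
    -- `u` separates `a` from the earlier jump times: these are charged to `(r, u]`, the jump at `a`
    -- to `(u, a]`.
    set u := F.sup id ⊔ r with hu
    have hua : u < a := sup_lt_iff.mpr ⟨(Finset.sup_lt_iff (by simpa using ha0)).mpr ha, hra⟩
    have h1 := ih r u le_sup_right fun s hs =>
      ⟨(hF s (Finset.mem_insert_of_mem hs)).1, (Finset.le_sup (f := id) hs).trans le_sup_left⟩
    have : (𝓝[<] a).NeBot := nhdsLT_neBot_of_exists_lt ⟨0, ha0⟩
    have h2 : v u ≤ v a - f a := by
      refine ge_of_tendsto (hl a ha0) ?_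
      filter_upwards [mem_nhdsWithin_of_mem_nhds (Ioi_mem_nhds hua)] with s hs
      exact hv (le_of_lt hs)
    linarith [hv hat]

theorem Monotone.summable_jumps (h0 : ∀ s, 0 ≤ f s) (hf0 : f 0 = 0) (hv : Monotone v)
    (hl : ∀ t, 0 < t → Tendsto v (𝓝[<] t) (𝓝 (v t - f t))) (t : ℝ≥0) :
    Summable (fun s : Set.Iic t => f s) := by
  rw [show (fun s : Set.Iic t => f s) = f ∘ Subtype.val from rfl, summable_subtype_iff_indicator]
  refine summable_of_sum_le (c := v t - v 0) (fun s => Set.indicator_nonneg (fun s _ => h0 s) s)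
    fun F => ?_
  rw [Finset.sum_indicator_eq_sum_filter]
  -- The increment `v t - v 0` controls only jumps in `(0, t]`; the term at `0` vanishes by `hf0`.
  refine le_trans (le_of_eq ?_) (Monotone.sum_jumps_le (f := f) hv hl
    ((F.filter fun s => s ≤ t).erase 0) 0 t zero_le ?_)
  · rw [Finset.sum_erase _ hf0]
    rfl
  · intro s hs
    simp only [Finset.mem_erase, Finset.mem_filter] at hs
    exact ⟨pos_iff_ne_zero.mpr hs.1, hs.2.2⟩

end JumpSum

theorem CadlagPath.jump_zero (x : CadlagPath) : x.jump 0 = 0 := by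
  rw [CadlagPath.jump, leftLim_eq_of_isBot (a := (0 : ℝ≥0)) fun _ => zero_le, sub_self]

theorem CadlagPath.tendsto_left (x : CadlagPath) (t : ℝ≥0) :
    Tendsto x (𝓝[<] t) (𝓝 (x t - x.jump t)) := by
  have := tendsto_leftLim_of_tendsto (x.isCadlag t).2
  rwa [CadlagPath.jump, sub_sub_cancel]

/-- A function has the Lebesgue decomposition iff it is increasing and right-continuous,
starts at zero and its jumps are the squared jumps of `x`. -/
theorem hasLebesgueDecomposition_iff (x : CadlagPath) (v : ℝ≥0 → ℝ) :
    HasLebesgueDecomposition x v ↔ Monotone v ∧ v 0 = 0 ∧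
      (∀ t, ContinuousWithinAt v (Set.Ici t) t) ∧
      ∀ t, Tendsto v (𝓝[<] t) (𝓝 (v t - x.jump t ^ 2)) := by
  have h0 : ∀ s, 0 ≤ x.jump s ^ 2 := fun s => sq_nonneg _
  constructor
  · rintro ⟨c, hc, hcm, hc0, h⟩
    have hs := fun t => (h t).1
    obtain rfl : v = fun t => c t + ∑' s : Set.Iic t, x.jump s ^ 2 := funext fun t => (h t).2
    refine ⟨hcm.add (tsum_Iic_mono (f := fun s => x.jump s ^ 2) h0 hs), ?_, fun t => ?_, fun t => ?_⟩
    · have : (0 : ℝ) = ∑' s : Set.Iic (0 : ℝ≥0), x.jump s ^ 2 := by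
        rw [← tsum_zero (α := ℝ) (β := Set.Iic (0 : ℝ≥0))]
        refine tsum_congr fun s => ?_
        have : (s : ℝ≥0) = 0 := le_antisymm s.2 zero_le
        rw [this, x.jump_zero]
        norm_num
      simp only [hc0, ← this, add_zero]
    · exact hc.continuousWithinAt.add (tsum_Iic_rightCont (f := fun s => x.jump s ^ 2) h0 hs t)
    · have := (hc.continuousWithinAt (s := Set.Iio t) (x := t)).tendsto.add
        (tsum_Iic_leftLim (f := fun s => x.jump s ^ 2) h0 hs t)
      simpa only [add_sub_assoc] using this
  · rintro ⟨hm, hv0, hr, hl⟩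
    have hz : x.jump 0 ^ 2 = 0 := by rw [x.jump_zero]; norm_num
    have hs : ∀ t : ℝ≥0, Summable (fun s : Set.Iic t => x.jump s ^ 2) :=
      Monotone.summable_jumps (f := fun s => x.jump s ^ 2) h0 hz hm fun t _ => hl t
    refine ⟨fun t => v t - ∑' s : Set.Iic t, x.jump s ^ 2, ?_, ?_, ?_, fun t => ⟨hs t, by ring⟩⟩
    -- From the left, `v` and the jump sum have the same jump, which cancels; from the right both
    -- are continuous.
    · refine continuous_iff_continuousAt.mpr fun t =>
        continuousAt_iff_continuous_left'_right'.mpr ⟨?_, ?_⟩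
      · have := (hl t).sub (tsum_Iic_leftLim (f := fun s => x.jump s ^ 2) h0 hs t)
        rw [sub_sub_sub_cancel_right] at this
        exact this
      · have := (hr t).sub (tsum_Iic_rightCont (f := fun s => x.jump s ^ 2) h0 hs t)
        exact ContinuousWithinAt.mono this Set.Ioi_subset_Ici_self
    · intro r t hrt
      have h1 := tsum_Iic_sub_tsum_Iic (f := fun s => x.jump s ^ 2) hs hrt
      have h2 : ∑' s, (Set.Ioc r t).indicator (fun s => x.jump s ^ 2) s ≤ v t - v r := by
        refine Real.tsum_le_of_sum_le (fun s => Set.indicator_nonneg (fun s _ => h0 s) s)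
          fun F => ?_
        rw [Finset.sum_indicator_eq_sum_filter]
        exact Monotone.sum_jumps_le (f := fun s => x.jump s ^ 2) hm (fun t _ => hl t) _ r t hrt
          fun s hs => (Finset.mem_filter.mp hs).2
      simp only
      linarith
    · have : ∑' s : Set.Iic (0 : ℝ≥0), x.jump s ^ 2 = 0 := by
        rw [← tsum_zero (α := ℝ) (β := Set.Iic (0 : ℝ≥0))]
        refine tsum_congr fun s => ?_
        have : (s : ℝ≥0) = 0 := le_antisymm s.2 zero_le
        rw [this, hz]
      simp only [hv0, this, sub_zero]

end PathwiseQV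

/-! ### Partitions, straddling intervals, and the comparison of `s_n` with `q_n`. -/

namespace PathwiseQV

namespace TimePartition

variable (p : TimePartition) (x : CadlagPath) {i j : ℕ} {u : ℝ≥0}

/-- The sum of the first `j` squared increments of `x` along `p`. -/
noncomputable def partialSum (j : ℕ) : ℝ :=
  ∑ i ∈ Finset.range j, (x (p.t (i + 1)) - x (p.t i)) ^ 2

theorem partialSum_succ (j : ℕ) :
    p.partialSum x (j + 1) = p.partialSum x j + (x (p.t (j + 1)) - x (p.t j)) ^ 2 :=
  Finset.sum_range_succ _ _

variable {p}

theorem t_lt_t (hij : i < j) (hj : j ≤ p.k) : p.t i < p.t j :=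
  p.strictMonoOn (hij.le.trans hj) hj hij

theorem t_le_t (hij : i ≤ j) (hj : j ≤ p.k) : p.t i ≤ p.t j :=
  p.strictMonoOn.monotoneOn (hij.trans hj) hj hij

theorem lt_of_t_lt_t (hi : i ≤ p.k) (hj : j ≤ p.k) (h : p.t i < p.t j) : i < j :=
  (p.strictMonoOn.lt_iff_lt hi hj).mp h

variable (p) in
theorem qSum_mono : Monotone (p.qSum x) := by
  intro u v huv
  refine Finset.sum_le_sum_of_subset_of_nonneg ?_ fun _ _ _ => sq_nonneg _
  exact Finset.monotone_filter_right _ fun i _ hi => le_trans hi huv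

/-- The increment over `[t_j, t_{j+1}]` is counted in full from time `t_j` on; hence the shift to `j
+ 1` in the two lemmas that follow. -/
theorem qSum_le_partialSum (hj : j ≤ p.k) (hu : u < p.t j) : p.qSum x u ≤ p.partialSum x j := by
  refine Finset.sum_le_sum_of_subset_of_nonneg (fun i hi => ?_) fun _ _ _ => sq_nonneg _
  rw [Finset.mem_filter, Finset.mem_range] at hi
  exact Finset.mem_range.mpr (lt_of_t_lt_t hi.1.le hj (hi.2.trans_lt hu))

theorem partialSum_le_qSum (hj : j < p.k) (hu : p.t j ≤ u) :
    p.partialSum x (j + 1) ≤ p.qSum x u := by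
  refine Finset.sum_le_sum_of_subset_of_nonneg (fun i hi => ?_) fun _ _ _ => sq_nonneg _
  have hij := Nat.lt_succ_iff.mp (Finset.mem_range.mp hi)
  exact Finset.mem_filter.mpr
    ⟨Finset.mem_range.mpr (hij.trans_lt hj), (t_le_t hij hj.le).trans hu⟩

theorem qSum_eq_partialSum (hj : j < p.k) (hu : p.t j ≤ u) (hu' : u < p.t (j + 1)) :
    p.qSum x u = p.partialSum x (j + 1) :=
  le_antisymm (qSum_le_partialSum x hj hu') (partialSum_le_qSum x hj hu)

theorem sSum_eq (hj : j < p.k) (hu : p.t j ≤ u) (hu' : u < p.t (j + 1)) :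
    p.sSum x u = p.partialSum x j + (x u - x (p.t j)) ^ 2 := by
  have hsub : Finset.range (j + 1) ⊆ Finset.range p.k := Finset.range_subset_range.mpr hj
  rw [sSum, ← Finset.sum_subset hsub, Finset.sum_range_succ, partialSum]
  · rw [min_eq_right hu'.le, min_eq_left hu, sq_abs]
    congr 1
    refine Finset.sum_congr rfl fun i hi => ?_
    have hi := Finset.mem_range.mp hi
    rw [min_eq_left ((t_le_t hi hj.le).trans hu), min_eq_left ((t_le_t hi.le hj.le).trans hu),
      sq_abs]
  · intro i hi hi'
    have hi := Finset.mem_range.mp hi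
    have hji : j + 1 ≤ i := not_lt.mp fun h => hi' (Finset.mem_range.mpr h)
    have h1 := hu'.le.trans (t_le_t hji hi.le)
    rw [min_eq_right h1, min_eq_right (h1.trans (t_lt_t (Nat.lt_succ_self i) hi).le)]
    simp

theorem exists_mem_Ico (hu : u < p.t p.k) : ∃ j < p.k, p.t j ≤ u ∧ u < p.t (j + 1) := by
  have key : ∀ m ≤ p.k, u < p.t m → ∃ j < m, p.t j ≤ u ∧ u < p.t (j + 1) := by
    intro m
    induction m with
    | zero => intro _ h; rw [p.t_zero] at h; exact absurd h not_lt_zero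
    | succ m ih =>
      intro hm h
      by_cases h' : p.t m ≤ u
      · exact ⟨m, Nat.lt_succ_self m, h', h⟩
      · obtain ⟨j, hj, h2⟩ := ih (by lia) (not_le.mp h')
        exact ⟨j, hj.trans (Nat.lt_succ_self m), h2⟩
  exact key p.k le_rfl hu

theorem exists_mem_Ioc (h0 : 0 < u) (hu : u ≤ p.t p.k) :
    ∃ j < p.k, p.t j < u ∧ u ≤ p.t (j + 1) := by
  have key : ∀ m ≤ p.k, u ≤ p.t m → ∃ j < m, p.t j < u ∧ u ≤ p.t (j + 1) := by
    intro m
    induction m with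
    | zero => intro _ h; rw [p.t_zero] at h; exact absurd h (not_le.mpr h0)
    | succ m ih =>
      intro hm h
      by_cases h' : p.t m < u
      · exact ⟨m, Nat.lt_succ_self m, h', h⟩
      · obtain ⟨j, hj, h2⟩ := ih (by lia) (not_lt.mp h')
        exact ⟨j, hj.trans (Nat.lt_succ_self m), h2⟩
  exact key p.k le_rfl hu

/-- The mesh sees intervals truncated at `T`; `hT` leaves room for an interval of length `δ` to
remain visible. -/
theorem t_succ_lt_of_mesh_lt {T δ : ℝ≥0} (hi : i < p.k) (hT : p.t i + δ ≤ T)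
    (hm : p.mesh T < δ) : p.t (i + 1) < p.t i + δ := by
  by_contra! h
  have h1 : min (p.t (i + 1)) T - min (p.t i) T ≤ p.mesh T :=
    Finset.le_sup (f := fun i => min (p.t (i + 1)) T - min (p.t i) T) (Finset.mem_range.mpr hi)
  have h2 : δ ≤ min (p.t (i + 1)) T - min (p.t i) T := by
    refine le_tsub_of_add_le_left ?_
    exact (add_le_add_left (min_le_left _ _) δ).trans (le_min h hT)
  exact absurd hm (not_lt.mpr (h2.trans h1))

end TimePartition

variable {π : ℕ → TimePartition} {x : CadlagPath} {u : ℝ≥0} {j : ℕ → ℕ}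

namespace IsPartitionSequence

theorem eventually_t_succ_lt (hπ : IsPartitionSequence π) (T : ℝ≥0) {δ : ℝ≥0} (hδ : 0 < δ) :
    ∀ᶠ n in atTop, ∀ i < (π n).k, (π n).t i ≤ T → (π n).t (i + 1) < (π n).t i + δ := by
  filter_upwards [(hπ.tendsto_mesh (T + δ)).eventually (Iio_mem_nhds hδ)] with n hn i hi hiT
  exact TimePartition.t_succ_lt_of_mesh_lt hi (add_le_add_left hiT δ) hn

theorem tendsto_t_succ (hπ : IsPartitionSequence π) (hj : ∀ᶠ n in atTop, j n < (π n).k)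
    (hu : Tendsto (fun n => (π n).t (j n)) atTop (𝓝 u)) :
    Tendsto (fun n => (π n).t (j n + 1)) atTop (𝓝 u) := by
  refine tendsto_order.mpr ⟨fun a ha => ?_, fun b hb => ?_⟩
  · filter_upwards [hj, hu.eventually (Ioi_mem_nhds ha)] with n h1 h2
    exact lt_trans h2 (TimePartition.t_lt_t (Nat.lt_succ_self _) h1)
  · obtain ⟨c, huc, hcb⟩ := exists_between hb
    filter_upwards [hj, hu.eventually (Iio_mem_nhds huc),
      hπ.eventually_t_succ_lt c (tsub_pos_of_lt hcb)] with n h1 h2 h3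
    refine (h3 _ h1 (le_of_lt h2)).trans ?_
    exact (add_lt_add_left h2 (b - c)).trans_eq (add_tsub_cancel_of_le hcb.le)

theorem tendsto_t_of_straddle (hπ : IsPartitionSequence π)
    (hj : ∀ᶠ n in atTop, j n < (π n).k ∧ (π n).t (j n) ≤ u ∧ u ≤ (π n).t (j n + 1)) :
    Tendsto (fun n => (π n).t (j n)) atTop (𝓝 u) := by
  refine tendsto_order.mpr ⟨fun a ha => ?_, fun b hb => ?_⟩
  · filter_upwards [hj, hπ.eventually_t_succ_lt u (tsub_pos_of_lt ha)] with n h1 h3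
    have h4 := h1.2.2.trans_lt (h3 _ h1.1 h1.2.1)
    by_contra! h
    have h5 := add_le_add_left h (u - a)
    rw [add_tsub_cancel_of_le ha.le] at h5
    exact absurd h4 (not_lt.mpr h5)
  · filter_upwards [hj] with n h
    exact h.2.1.trans_lt hb

theorem exists_straddle_Ico (hπ : IsPartitionSequence π) (u : ℝ≥0) : ∃ j : ℕ → ℕ,
    (∀ᶠ n in atTop, j n < (π n).k ∧ (π n).t (j n) ≤ u ∧ u < (π n).t (j n + 1)) ∧
    Tendsto (fun n => (π n).t (j n)) atTop (𝓝 u) ∧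
    Tendsto (fun n => (π n).t (j n + 1)) atTop (𝓝 u) := by
  have h : ∀ n, ∃ j, u < (π n).t (π n).k → j < (π n).k ∧ (π n).t j ≤ u ∧ u < (π n).t (j + 1) :=
    fun n => by
      by_cases hu : u < (π n).t (π n).k
      · obtain ⟨j, hj⟩ := TimePartition.exists_mem_Ico hu
        exact ⟨j, fun _ => hj⟩
      · exact ⟨0, fun h => absurd h hu⟩
  choose j hj using h
  have hj' := (hπ.tendsto_last.eventually_gt_atTop u).mono fun n hn => hj n hn
  have h1 := hπ.tendsto_t_of_straddle (hj'.mono fun n h => ⟨h.1, h.2.1, h.2.2.le⟩)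
  exact ⟨j, hj', h1, hπ.tendsto_t_succ (hj'.mono fun n h => h.1) h1⟩

/-- The strict inequality is on the left here, so that the increment over the interval captures the
jump of `x` at `u`. -/
theorem exists_straddle_Ioc (hπ : IsPartitionSequence π) (hu : 0 < u) : ∃ j : ℕ → ℕ,
    (∀ᶠ n in atTop, j n < (π n).k ∧ (π n).t (j n) < u ∧ u ≤ (π n).t (j n + 1)) ∧
    Tendsto (fun n => (π n).t (j n)) atTop (𝓝 u) ∧
    Tendsto (fun n => (π n).t (j n + 1)) atTop (𝓝 u) := by
  have h : ∀ n, ∃ j, u ≤ (π n).t (π n).k → j < (π n).k ∧ (π n).t j < u ∧ u ≤ (π n).t (j + 1) :=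
    fun n => by
      by_cases hu' : u ≤ (π n).t (π n).k
      · obtain ⟨j, hj⟩ := TimePartition.exists_mem_Ioc hu hu'
        exact ⟨j, fun _ => hj⟩
      · exact ⟨0, fun h => absurd h hu'⟩
  choose j hj using h
  have hj' := (hπ.tendsto_last.eventually_ge_atTop u).mono fun n hn => hj n hn
  have h1 := hπ.tendsto_t_of_straddle (hj'.mono fun n h => ⟨h.1, h.2.1.le, h.2.2⟩)
  exact ⟨j, hj', h1, hπ.tendsto_t_succ (hj'.mono fun n h => h.1) h1⟩

end IsPartitionSequence

/-- Near `t`, a càdlàg path is close to `x t` on the right and to `x (t-)` on the left. -/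
theorem CadlagPath.tendsto_sub_step (x : CadlagPath) (t : ℝ≥0) :
    Tendsto (fun s => x s - if t ≤ s then x t else x t - x.jump t) (𝓝 t) (𝓝 0) := by
  rw [← nhdsLT_sup_nhdsGE]
  refine Tendsto.sup ?_ ?_
  · have := (x.tendsto_left t).sub_const (x t - x.jump t)
    rw [sub_self] at this
    refine this.congr' ?_
    filter_upwards [self_mem_nhdsWithin] with s hs
    rw [if_neg (not_le.mpr hs)]
  · have := (x.isCadlag t).1.tendsto.sub_const (x t)
    rw [sub_self] at this
    refine this.congr' ?_
    filter_upwards [self_mem_nhdsWithin] with s hs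
    rw [if_pos (Set.mem_Ici.mp hs)]

/-- Covers endpoints on either side of `t`, even when the side varies with `n`. -/
theorem CadlagPath.tendsto_increment_sub_step (x : CadlagPath) {a b : ℕ → ℝ≥0} {t : ℝ≥0}
    (ha : Tendsto a atTop (𝓝 t)) (hb : Tendsto b atTop (𝓝 t)) :
    Tendsto (fun n => (x (b n) - x (a n)) - ((if t ≤ b n then x t else x t - x.jump t) -
      if t ≤ a n then x t else x t - x.jump t)) atTop (𝓝 0) := by
  have := ((x.tendsto_sub_step t).comp hb).sub ((x.tendsto_sub_step t).comp ha)
  rw [sub_zero] at this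
  refine this.congr fun n => ?_
  simp only [Function.comp]
  ring

theorem CadlagPath.tendsto_increment_jump (x : CadlagPath) {a b : ℕ → ℝ≥0} {t : ℝ≥0}
    (ha : Tendsto a atTop (𝓝 t)) (hb : Tendsto b atTop (𝓝 t))
    (hab : ∀ᶠ n in atTop, a n < t ∧ t ≤ b n) :
    Tendsto (fun n => x (b n) - x (a n)) atTop (𝓝 (x.jump t)) := by
  have := (x.tendsto_increment_sub_step ha hb).add_const (x.jump t)
  rw [zero_add] at this
  refine this.congr' ?_
  filter_upwards [hab] with n hn
  rw [if_pos hn.2, if_neg (not_le.mpr hn.1)]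
  ring

/-- The sums `s` and `q` are asymptotically equal, for every càdlàg path. -/
theorem tendsto_sSum_sub_qSum (hπ : IsPartitionSequence π) (x : CadlagPath) (t : ℝ≥0) :
    Tendsto (fun n => (π n).sSum x t - (π n).qSum x t) atTop (𝓝 0) := by
  obtain ⟨j, hj, h1, h2⟩ := hπ.exists_straddle_Ico t
  have hA := x.tendsto_increment_sub_step h1 (tendsto_const_nhds (x := t))
  have hB := x.tendsto_increment_sub_step h1 h2
  have hC := x.tendsto_increment_sub_step h2 (tendsto_const_nhds (x := t))
  have hC' : Tendsto (fun n => x t - x ((π n).t (j n + 1))) atTop (𝓝 0) := by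
    refine hC.congr' ?_
    filter_upwards [hj] with n hn
    rw [if_pos le_rfl, if_pos hn.2.2.le]
    ring
  -- The difference of the sums is a difference of two squares: one factor tends to `0` by `hC'`,
  -- the other is bounded because each increment is within `1` of `0` or of the jump.
  have hbd : ∀ᶠ n in atTop,
      |x t - x ((π n).t (j n)) + (x ((π n).t (j n + 1)) - x ((π n).t (j n)))| ≤
        2 * |x.jump t| + 2 := by
    filter_upwards [hA.eventually (Metric.ball_mem_nhds 0 one_pos),
      hB.eventually (Metric.ball_mem_nhds 0 one_pos), hj] with n ha hb hn
    rw [Real.dist_eq, sub_zero, abs_lt] at ha hb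
    rw [if_pos le_rfl] at ha
    rw [if_pos hn.2.2.le] at hb
    have h3 := abs_nonneg (x.jump t)
    have h4 := le_abs_self (x.jump t)
    have h5 := neg_abs_le (x.jump t)
    split_ifs at ha hb <;> rw [abs_le] <;>
      constructor <;> linarith [ha.1, ha.2, hb.1, hb.2]
  have hprod := hC'.zero_mul_isBoundedUnder_le (g := fun n =>
    x t - x ((π n).t (j n)) + (x ((π n).t (j n + 1)) - x ((π n).t (j n))))
    ⟨2 * |x.jump t| + 2, by simpa [eventually_map] using hbd⟩
  refine hprod.congr' ?_
  filter_upwards [hj] with n hn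
  rw [TimePartition.sSum_eq x hn.1 hn.2.1 hn.2.2,
    TimePartition.qSum_eq_partialSum x hn.1 hn.2.1 hn.2.2, TimePartition.partialSum_succ]
  ring

theorem isLimitS_iff_isLimitQ (hπ : IsPartitionSequence π) (x : CadlagPath) (v : ℝ≥0 → ℝ) :
    IsLimitS π x v ↔ IsLimitQ π x v := by
  refine forall_congr' fun t => ?_
  have h := tendsto_sSum_sub_qSum hπ x t
  constructor
  · intro hs
    simpa using hs.sub h
  · intro hq
    simpa using hq.add h

/-- No interval straddles `0` from the left, so time `0` is settled through `sSum`, which vanishes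
there. -/
theorem tendsto_qSum_zero (hπ : IsPartitionSequence π) (x : CadlagPath) :
    Tendsto (fun n => (π n).qSum x 0) atTop (𝓝 0) := by
  have h0 : ∀ n, (π n).sSum x 0 = 0 := fun n => by simp [TimePartition.sSum]
  simpa [h0] using (tendsto_sSum_sub_qSum hπ x 0).neg

/-- If the sums `q` asymptotically exceed every number below `c` before `u`, then the squared
increment over the partition interval containing `u` brings them above those below `c + Δx(u)²`. -/
theorem eventually_lt_partialSum (hπ : IsPartitionSequence π) {c : ℝ}
    (hlow : ∀ a < c, ∃ r < u, ∀ᶠ n in atTop, a < (π n).qSum x r)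
    (hj : ∀ᶠ n in atTop, j n < (π n).k ∧ (π n).t (j n) < u ∧ u ≤ (π n).t (j n + 1)) {a : ℝ}
    (ha : a < c + x.jump u ^ 2) : ∀ᶠ n in atTop, a < (π n).partialSum x (j n + 1) := by
  have h1 := hπ.tendsto_t_of_straddle (hj.mono fun n h => ⟨h.1, h.2.1.le, h.2.2⟩)
  have h2 := hπ.tendsto_t_succ (hj.mono fun n h => h.1) h1
  have hinc := (x.tendsto_increment_jump h1 h2 (hj.mono fun n h => h.2)).pow 2
  -- One `e` is lost on the sum before `u`, the other on the straddling increment.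
  obtain ⟨e, he, hea⟩ : ∃ e > 0, a + 2 * e < c + x.jump u ^ 2 :=
    ⟨(c + x.jump u ^ 2 - a) / 4, by linarith, by linarith⟩
  obtain ⟨r, hr, hra⟩ := hlow (c - e) (by linarith)
  filter_upwards [hj, hra, h1.eventually (Ioi_mem_nhds hr),
    hinc.eventually (Ioi_mem_nhds (sub_lt_self (x.jump u ^ 2) he))] with n g1 g2 g3 g4
  rw [TimePartition.partialSum_succ]
  have := TimePartition.qSum_le_partialSum x g1.1.le g3
  have g4 : x.jump u ^ 2 - e < _ := g4
  linarith

end PathwiseQV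

/-! ### Vague convergence versus convergence of distribution functions. -/

namespace PathwiseQV

theorem isCompact_Icc_zero (t : ℝ≥0) : IsCompact (Set.Icc 0 t) := isCompact_Icc

theorem integral_indicator_Icc_const (m : Measure ℝ≥0) (c : ℝ) (t : ℝ≥0) :
    ∫ s, (Set.Icc 0 t).indicator (fun _ => c) s ∂m = m.real (Set.Icc 0 t) * c := by
  rw [integral_indicator_const _ measurableSet_Icc, smul_eq_mul]

theorem integrable_indicator_Icc_const (m : Measure ℝ≥0) [IsFiniteMeasureOnCompacts m]
    (c : ℝ) (t : ℝ≥0) : Integrable ((Set.Icc 0 t).indicator fun _ => c) m :=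
  (integrable_indicator_iff measurableSet_Icc).mpr
    (integrableOn_const (isCompact_Icc_zero t).measure_lt_top.ne)

section DistributionFunction

variable {m : ℕ → Measure ℝ≥0} {μ : Measure ℝ≥0}

/-- A continuous cutoff function whose integrals lie between `m [0,a]` and `m [0,b]`. -/
theorem exists_cutoff {a b : ℝ≥0} (hab : a < b) : ∃ f : ℝ≥0 → ℝ, Continuous f ∧
    HasCompactSupport f ∧ ∀ m : Measure ℝ≥0, IsFiniteMeasureOnCompacts m →
      m.real (Set.Icc 0 a) ≤ ∫ s, f s ∂m ∧ ∫ s, f s ∂m ≤ m.real (Set.Icc 0 b) := by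
  obtain ⟨f, hf1, hfs, hfc, hf01⟩ := exists_continuous_one_zero_of_isCompact
    (isCompact_Icc_zero a) (isClosed_Ici (a := b)) (Set.disjoint_left.mpr fun s hs hs' =>
      absurd hab (not_lt.mpr (le_trans hs' hs.2)))
  refine ⟨f, f.continuous, hfc, fun m hm => ?_⟩
  have hfi : Integrable f m := f.continuous.integrable_of_hasCompactSupport hfc
  rw [← mul_one (m.real (Set.Icc 0 a)), ← mul_one (m.real (Set.Icc 0 b)),
    ← integral_indicator_Icc_const, ← integral_indicator_Icc_const]
  refine ⟨integral_mono (integrable_indicator_Icc_const m 1 a) hfi fun s => ?_,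
    integral_mono hfi (integrable_indicator_Icc_const m 1 b) fun s => ?_⟩
  · exact Set.indicator_le' (fun s hs => (hf1 hs).ge) (fun s _ => (hf01 s).1) s
  · by_cases hs : s < b
    · simpa [Set.indicator, hs.le] using (hf01 s).2
    · rw [show f s = 0 from hfs (not_lt.mp hs)]
      exact Set.indicator_nonneg (fun _ _ => zero_le_one) s

theorem TendstoVaguely.eventually_lt [∀ n, IsFiniteMeasureOnCompacts (m n)]
    [IsFiniteMeasureOnCompacts μ] (h : TendstoVaguely m μ) {a b : ℝ≥0} (hab : a < b) {c : ℝ}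
    (hc : c < μ.real (Set.Icc 0 a)) : ∀ᶠ n in atTop, c < (m n).real (Set.Icc 0 b) := by
  obtain ⟨f, hf, hfc, hfm⟩ := exists_cutoff hab
  filter_upwards [(h f hf hfc).eventually (Ioi_mem_nhds (hc.trans_le (hfm μ ‹_›).1))] with n hn
  exact lt_of_lt_of_le hn (hfm (m n) inferInstance).2

theorem TendstoVaguely.eventually_gt [∀ n, IsFiniteMeasureOnCompacts (m n)]
    [IsFiniteMeasureOnCompacts μ] (h : TendstoVaguely m μ) {a b : ℝ≥0} (hab : a < b) {c : ℝ}
    (hc : μ.real (Set.Icc 0 b) < c) : ∀ᶠ n in atTop, (m n).real (Set.Icc 0 a) < c := by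
  obtain ⟨f, hf, hfc, hfm⟩ := exists_cutoff hab
  filter_upwards [(h f hf hfc).eventually (Iio_mem_nhds ((hfm μ ‹_›).2.trans_lt hc))] with n hn
  exact lt_of_le_of_lt (hfm (m n) inferInstance).1 hn

/-- `g` is a combination of indicators of intervals `[0, t]`, for which `h` gives convergence of
integrals: it takes on each grid cell the value of `f` at the right end. The bound also forces `g =
0` beyond the grid, which the induction uses. -/
theorem exists_step_approximation [∀ n, IsFiniteMeasureOnCompacts (m n)]
    [IsFiniteMeasureOnCompacts μ]
    (h : ∀ t, Tendsto (fun n => (m n).real (Set.Icc 0 t)) atTop (𝓝 (μ.real (Set.Icc 0 t))))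
    {f : ℝ≥0 → ℝ} {δ : ℝ≥0} {ε : ℝ} (hε : 0 ≤ ε)
    (hf : ∀ r s, r ≤ s → s ≤ r + δ → |f r - f s| ≤ ε) (M : ℕ) : ∃ g : ℝ≥0 → ℝ,
      (∀ n, Integrable g (m n)) ∧ Integrable g μ ∧
      Tendsto (fun n => ∫ s, g s ∂(m n)) atTop (𝓝 (∫ s, g s ∂μ)) ∧
      ∀ s, |(Set.Icc 0 (M * δ)).indicator f s - g s| ≤
        (Set.Icc 0 (M * δ)).indicator (fun _ => ε) s := by
  induction M with
  | zero =>
    refine ⟨(Set.Icc 0 0).indicator fun _ => f 0, fun n => integrable_indicator_Icc_const _ _ _,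
      integrable_indicator_Icc_const _ _ _, ?_, fun s => ?_⟩
    · simp only [integral_indicator_Icc_const]
      exact (h 0).mul_const _
    · rcases eq_or_ne s 0 with rfl | hs <;> simp [Set.indicator, *]
  | succ M ih =>
    obtain ⟨g, h1, h2, h3, h4⟩ := ih
    set a : ℝ≥0 := M * δ with ha
    have hb : ((M + 1 : ℕ) : ℝ≥0) * δ = a + δ := by push_cast; ring
    rw [hb]
    set d : ℝ≥0 → ℝ := fun s => (Set.Icc 0 (a + δ)).indicator (fun _ => f (a + δ)) s -
      (Set.Icc 0 a).indicator (fun _ => f (a + δ)) s with hd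
    have hdi : ∀ ν : Measure ℝ≥0, IsFiniteMeasureOnCompacts ν → Integrable d ν := fun ν _ =>
      (integrable_indicator_Icc_const _ _ _).sub (integrable_indicator_Icc_const _ _ _)
    have hdint : ∀ ν : Measure ℝ≥0, IsFiniteMeasureOnCompacts ν → ∫ s, d s ∂ν =
        ν.real (Set.Icc 0 (a + δ)) * f (a + δ) - ν.real (Set.Icc 0 a) * f (a + δ) := fun ν _ => by
      rw [hd, integral_sub (integrable_indicator_Icc_const _ _ _)
        (integrable_indicator_Icc_const _ _ _), integral_indicator_Icc_const,
        integral_indicator_Icc_const]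
    refine ⟨fun s => g s + d s, fun n => (h1 n).add (hdi _ inferInstance),
      h2.add (hdi _ inferInstance), ?_, fun s => ?_⟩
    · rw [integral_add h2 (hdi _ inferInstance), hdint _ inferInstance]
      simp_rw [fun n => integral_add (h1 n) (hdi (m n) inferInstance),
        fun n => hdint (m n) inferInstance]
      exact h3.add (((h _).mul_const _).sub ((h _).mul_const _))
    · have h5 := h4 s
      by_cases hs : s ≤ a
      · have hs' : s ≤ a + δ := hs.trans le_self_add
        simpa [hd, Set.indicator, hs, hs'] using h5
      · have hg : g s = 0 := by simpa [Set.indicator, hs] using h5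
        by_cases hs' : s ≤ a + δ
        · simpa [hd, Set.indicator, hs, hs', hg] using
            hf s (a + δ) hs' (add_le_add_left (not_le.mp hs).le δ)
        · simp [hd, Set.indicator, hs, hs', hg]

/-- Convergence of the distribution functions implies vague convergence. -/
theorem tendstoVaguely_of_tendsto_Icc [∀ n, IsFiniteMeasureOnCompacts (m n)]
    [IsFiniteMeasureOnCompacts μ]
    (h : ∀ t, Tendsto (fun n => (m n).real (Set.Icc 0 t)) atTop (𝓝 (μ.real (Set.Icc 0 t)))) :
    TendstoVaguely m μ := by
  intro f hf hfc
  obtain ⟨T, hT⟩ : ∃ T : ℝ≥0, ∀ s, T < s → f s = 0 := by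
    obtain ⟨T, hT⟩ := hfc.isCompact.bddAbove
    exact ⟨T, fun s hs => image_eq_zero_of_notMem_tsupport fun h => not_le.mpr hs (hT h)⟩
  have hfi : ∀ ν : Measure ℝ≥0, IsFiniteMeasureOnCompacts ν → Integrable f ν := fun ν _ =>
    hf.integrable_of_hasCompactSupport hfc
  -- `C` bounds the mass of `[0, T + 1]` under `μ` and, eventually, under `m n`. Error `η / (4 * C)`
  -- then costs at most `η / 4` under each measure, and the convergence for `g` costs a third `η /
  -- 4`.
  set C := μ.real (Set.Icc 0 (T + 1)) + 1 with hC
  have hCpos : 0 < C := by positivity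
  refine Metric.tendsto_nhds.mpr fun η hη => ?_
  have hε : 0 < η / (4 * C) := by positivity
  obtain ⟨δ, hδ, hfδ⟩ := Metric.uniformContinuous_iff.mp
    (hfc.uniformContinuous_of_continuous hf) _ hε
  -- The grid width is `(T + 1) / M`, so that `M` cells cover `[0, T + 1]` exactly.
  obtain ⟨M, hM⟩ := exists_nat_gt ((T + 1 : ℝ) / δ)
  have hM0 : (0 : ℝ) < M := lt_of_le_of_lt (by positivity) hM
  have hM0' : (M : ℝ≥0) ≠ 0 := by exact_mod_cast hM0.ne'
  have hMδ : ((T + 1 : ℝ≥0) : ℝ) / M < δ := by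
    rw [div_lt_iff₀ hδ] at hM
    rw [div_lt_iff₀ hM0, mul_comm]
    push_cast
    exact hM
  obtain ⟨g, hg1, hg2, hg3, hg4⟩ := exists_step_approximation h (f := f) (δ := (T + 1) / M) hε.le
    (fun r s hrs hsr => by
      refine (hfδ ?_).le
      rw [NNReal.dist_eq, abs_sub_comm, abs_of_nonneg (sub_nonneg.mpr (NNReal.coe_le_coe.mpr hrs))]
      have : (s : ℝ) ≤ r + (T + 1 : ℝ≥0) / M := by exact_mod_cast hsr
      linarith) M
  rw [mul_div_cancel₀ _ hM0'] at hg4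
  have hfind : (Set.Icc 0 (T + 1)).indicator f = f := by
    funext s
    by_cases hs : s ≤ T + 1
    · simp [Set.indicator, hs]
    · rw [hT s (lt_of_le_of_lt le_self_add (not_le.mp hs))]
      simp [Set.indicator, hs]
  rw [hfind] at hg4
  have happ : ∀ ν : Measure ℝ≥0, IsFiniteMeasureOnCompacts ν → Integrable g ν →
      |∫ s, f s ∂ν - ∫ s, g s ∂ν| ≤ ν.real (Set.Icc 0 (T + 1)) * (η / (4 * C)) := by
    intro ν _ hgν
    rw [← integral_sub (hfi ν inferInstance) hgν, ← Real.norm_eq_abs,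
      ← integral_indicator_Icc_const]
    exact norm_integral_le_of_norm_le (integrable_indicator_Icc_const _ _ _)
      (Eventually.of_forall hg4)
  have hlarge : ∀ r ≤ C, r * (η / (4 * C)) ≤ η / 4 := fun r hr => by
    calc r * (η / (4 * C)) ≤ C * (η / (4 * C)) := mul_le_mul_of_nonneg_right hr hε.le
      _ = η / 4 := by field_simp
  have h1 := (happ μ inferInstance hg2).trans (hlarge _ (by linarith))
  filter_upwards [(h (T + 1)).eventually (Iio_mem_nhds (lt_add_one _)),
    hg3.eventually (Metric.ball_mem_nhds _ (show 0 < η / 4 by positivity))] with n hn1 hn2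
  have h2 := (happ (m n) inferInstance (hg1 n)).trans (hlarge _ (le_of_lt hn1))
  rw [Real.dist_eq] at hn2 ⊢
  rw [abs_le] at h1 h2
  rw [abs_lt] at hn2 ⊢
  constructor <;> linarith [h1.1, h1.2, h2.1, h2.2, hn2.1, hn2.2]

end DistributionFunction

instance (p : TimePartition) (x : CadlagPath) : IsFiniteMeasure (p.measure x) := by
  refine ⟨?_⟩
  simp only [TimePartition.measure, Measure.coe_finsetSum, Finset.sum_apply, Measure.smul_apply,
    measure_univ, smul_eq_mul, mul_one]
  exact ENNReal.sum_lt_top.mpr fun i _ => ENNReal.ofReal_lt_top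

theorem TimePartition.measureReal_Icc (p : TimePartition) (x : CadlagPath) (t : ℝ≥0) :
    (p.measure x).real (Set.Icc 0 t) = p.qSum x t := by
  have h : p.measure x (Set.Icc 0 t) = ENNReal.ofReal (p.qSum x t) := by
    rw [TimePartition.qSum, Finset.sum_filter, ENNReal.ofReal_sum_of_nonneg fun i _ => by
      split_ifs <;> positivity]
    simp only [TimePartition.measure, Measure.coe_finsetSum, Finset.sum_apply,
      Measure.smul_apply, smul_eq_mul, Measure.dirac_apply' _ measurableSet_Icc]
    refine Finset.sum_congr rfl fun i _ => ?_
    by_cases hi : p.t i ≤ t <;> simp [Set.indicator, hi]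
  rw [measureReal_def, h, ENNReal.toReal_ofReal]
  exact Finset.sum_nonneg fun _ _ => sq_nonneg _

variable {π : ℕ → TimePartition} {x : CadlagPath} {v : ℝ≥0 → ℝ}

/-- This includes the atoms of `μ`, where vague convergence alone would not suffice: the straddling
increment supplies the atom's mass. -/
theorem isLimitQ_of_isQuadraticVariation (hπ : IsPartitionSequence π)
    (h : IsQuadraticVariation π x v) : IsLimitQ π x v := by
  obtain ⟨μ, hμ, hvague, hμv, hv⟩ := h
  obtain ⟨-, hv0, hr, hl⟩ := (hasLebesgueDecomposition_iff x v).mp hv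
  intro t
  rcases eq_or_ne t 0 with rfl | ht
  · rw [hv0]
    exact tendsto_qSum_zero hπ x
  have ht := pos_iff_ne_zero.mpr ht
  have hlow : ∀ a < v t - x.jump t ^ 2, ∃ r < t, ∀ᶠ n in atTop, a < (π n).qSum x r := by
    intro a ha
    have : (𝓝[<] t).NeBot := nhdsLT_neBot_of_exists_lt ⟨0, ht⟩
    obtain ⟨s, hs, hst⟩ := (((hl t).eventually_const_lt ha).and eventually_mem_nhdsWithin).exists
    obtain ⟨r, hsr, hrt⟩ := exists_between (Set.mem_Iio.mp hst)
    refine ⟨r, hrt, ?_⟩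
    rw [hμv] at hs
    simpa only [TimePartition.measureReal_Icc] using hvague.eventually_lt hsr hs
  refine tendsto_order.mpr ⟨fun a ha => ?_, fun b hb => ?_⟩
  · obtain ⟨j, hj, -⟩ := hπ.exists_straddle_Ioc ht
    rw [← sub_add_cancel (v t) (x.jump t ^ 2)] at ha
    filter_upwards [hj, eventually_lt_partialSum hπ hlow hj ha] with n h1 h2
    exact h2.trans_le (TimePartition.partialSum_le_qSum x h1.1 h1.2.1.le)
  · have hr' := (hr t).mono (Set.Ioi_subset_Ici_self)
    obtain ⟨s, hs, hts⟩ := ((hr'.tendsto.eventually_lt_const hb).and eventually_mem_nhdsWithin).exists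
    rw [hμv] at hs
    simpa only [TimePartition.measureReal_Icc] using
      hvague.eventually_gt (Set.mem_Ioi.mp hts) hs

theorem isQuadraticVariation_of_isLimitQ (h : IsLimitQ π x v)
    (hv : HasLebesgueDecomposition x v) : IsQuadraticVariation π x v := by
  obtain ⟨hm, hv0, hr, hl⟩ := (hasLebesgueDecomposition_iff x v).mp hv
  set F : StieltjesFunction ℝ≥0 := ⟨v, hm, hr⟩ with hF
  have hμ : ∀ t, v t = F.measure.real (Set.Icc 0 t) := fun t => by
    -- At the bottom element `leftLim` is the value itself, so `v 0 = 0` is what gives `[0, t]` the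
    -- mass `v t`.
    have h1 : Function.leftLim F 0 = 0 := by
      rw [leftLim_eq_of_isBot (a := (0 : ℝ≥0)) fun _ => zero_le]
      exact hv0
    rw [measureReal_def, StieltjesFunction.measure_Icc, h1, sub_zero, ENNReal.toReal_ofReal]
    exact hv0.symm.le.trans (hm zero_le)
  refine ⟨F.measure, inferInstance, tendstoVaguely_of_tendsto_Icc fun t => ?_, hμ, hv⟩
  simp only [TimePartition.measureReal_Icc, ← hμ]
  exact h t

/-- The quadratic variation is the limit of the sums `q`, if that has the Lebesgue
decomposition. -/
theorem isQuadraticVariation_iff (hπ : IsPartitionSequence π) :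
    IsQuadraticVariation π x v ↔ IsLimitQ π x v ∧ HasLebesgueDecomposition x v :=
  ⟨fun h => ⟨isLimitQ_of_isQuadraticVariation hπ h, h.choose_spec.2.2.2⟩,
    fun h => isQuadraticVariation_of_isLimitQ h.1 h.2⟩

end PathwiseQV

/-! ### From `J₁` convergence to pointwise convergence. -/

namespace PathwiseQV

variable {π : ℕ → TimePartition} {x q : CadlagPath} {v : ℝ≥0 → ℝ} {t : ℝ≥0}

theorem exists_lt_of_tendsto_left {v : ℝ≥0 → ℝ} {c a : ℝ} (ht : 0 < t)
    (hl : Tendsto v (𝓝[<] t) (𝓝 c)) (ha : a < c) : ∃ s < t, a < v s := by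
  have : (𝓝[<] t).NeBot := nhdsLT_neBot_of_exists_lt ⟨0, ht⟩
  obtain ⟨s, hs, hst⟩ := ((hl.eventually_const_lt ha).and eventually_mem_nhdsWithin).exists
  exact ⟨s, hst, hs⟩

theorem exists_gt_of_rightCont {v : ℝ≥0 → ℝ} {b : ℝ}
    (hr : ContinuousWithinAt v (Set.Ici t) t) (hb : v t < b) : ∃ s > t, v s < b := by
  have hr' := hr.mono Set.Ioi_subset_Ici_self
  obtain ⟨s, hs, hts⟩ := ((hr'.tendsto.eventually_lt_const hb).and eventually_mem_nhdsWithin).exists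
  exact ⟨s, hts, hs⟩

theorem le_of_tendsto_left_of_monotone {c : ℝ} (hm : Monotone v)
    (hl : Tendsto v (𝓝[<] t) (𝓝 c)) {s : ℝ≥0} (hs : s < t) : v s ≤ c := by
  have : (𝓝[<] t).NeBot := nhdsLT_neBot_of_exists_lt ⟨s, hs⟩
  refine ge_of_tendsto hl ?_
  filter_upwards [mem_nhdsWithin_of_mem_nhds (Ioi_mem_nhds hs)] with r hr
  exact hm (le_of_lt hr)

/-- If `q (λ s) → q s` along time changes tending to the identity, then the jumps of the limit
dominate the squared jumps of the path. -/
theorem sq_jump_le_jump (hπ : IsPartitionSequence π) {lam : ℕ → (ℝ≥0 ≃o ℝ≥0)}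
    (hlam : ∀ s, Tendsto (fun n => lam n s) atTop (𝓝 s))
    (hq : ∀ s, Tendsto (fun n => (π n).qSum x (lam n s)) atTop (𝓝 (q s))) (ht : 0 < t) :
    x.jump t ^ 2 ≤ q.jump t := by
  obtain ⟨j, hj, h1, h2⟩ := hπ.exists_straddle_Ioc ht
  have hinc := (x.tendsto_increment_jump h1 h2 (hj.mono fun n h => h.2)).pow 2
  -- Eventually `lam n a < t_j < lam n b`, so the straddling increment is counted between these
  -- times. Then `b ↓ t` and `a ↑ t`.
  have key : ∀ a < t, ∀ b > t, x.jump t ^ 2 + q a ≤ q b := by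
    intro a ha b hb
    refine le_of_tendsto_of_tendsto (hinc.add (hq a)) (hq b) ?_
    filter_upwards [hj, (hlam a).eventually_lt h1 ha, (hlam b).eventually_const_lt hb]
      with n g1 g2 g3
    have g4 := TimePartition.qSum_le_partialSum x g1.1.le g2
    have g5 := TimePartition.partialSum_le_qSum x g1.1 (g1.2.1.trans g3).le
    rw [TimePartition.partialSum_succ] at g5
    linarith
  have key2 : ∀ a < t, x.jump t ^ 2 + q a ≤ q t := fun a ha => by
    refine ge_of_tendsto ((q.isCadlag t).1.mono Set.Ioi_subset_Ici_self).tendsto ?_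
    filter_upwards [self_mem_nhdsWithin] with b hb
    exact key a ha b hb
  have : (𝓝[<] t).NeBot := nhdsLT_neBot_of_exists_lt ⟨0, ht⟩
  have h3 := le_of_tendsto ((q.tendsto_left t).const_add (x.jump t ^ 2)) (by
    filter_upwards [self_mem_nhdsWithin] with a ha
    exact key2 a ha)
  linarith

/-- A genuine jump of a `J₁`-limit of the sums `q` is a squared jump of the path. -/
theorem jump_eq_sq_jump_of_pos (hπ : IsPartitionSequence π) {lam : ℕ → (ℝ≥0 ≃o ℝ≥0)}
    (hlam : ∀ s, Tendsto (fun n => lam n s) atTop (𝓝 s))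
    (hunif : TendstoUniformlyOn (fun n s => (π n).qSum x (lam n s)) q atTop (Set.Iic t))
    (hm : Monotone q) (ht : 0 < t) (hD : 0 < q.jump t) : q.jump t = x.jump t ^ 2 := by
  have hl := q.tendsto_left t
  have hq : ∀ s ≤ t, Tendsto (fun n => (π n).qSum x (lam n s)) atTop (𝓝 (q s)) :=
    fun s hs => hunif.tendsto_at hs
  -- Uniformity is essential: all times before `lam n t` are pulled back to times before `t`, where
  -- `q` stays below its left limit.
  have hbelow : ∀ c, q t - q.jump t < c →
      ∀ᶠ n in atTop, ∀ r < lam n t, (π n).qSum x r < c := by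
    intro c hc
    filter_upwards [Metric.tendstoUniformlyOn_iff.mp hunif _ (sub_pos.mpr hc)] with n hn r hr
    have hs : (lam n).symm r < t := by
      rw [← (lam n).lt_iff_lt, OrderIso.apply_symm_apply]
      exact hr
    have h1 := hn _ hs.le
    rw [OrderIso.apply_symm_apply, Real.dist_eq, abs_lt] at h1
    linarith [le_of_tendsto_left_of_monotone hm hl hs, h1.1]
  -- The sum passes the level `q t - q.jump t / 2` exactly at `lam n t`, but is constant on each
  -- `[t_j, t_{j+1})`.
  have hpoint : ∀ᶠ n in atTop, ∃ j, j < (π n).k ∧ (π n).t j = lam n t := by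
    filter_upwards [hbelow (q t - q.jump t / 2) (by linarith),
      (hq t le_rfl).eventually_const_lt (show q t - q.jump t / 2 < q t by linarith),
      (hlam t).eventually_lt_const (lt_add_one t),
      hπ.tendsto_last.eventually_gt_atTop (t + 1)] with n h1 h2 h3 h4
    obtain ⟨j, hjk, hj1, hj2⟩ := TimePartition.exists_mem_Ico (h3.trans h4)
    refine ⟨j, hjk, hj1.eq_or_lt.resolve_right fun hlt => ?_⟩
    have h5 := h1 _ hlt
    rw [TimePartition.qSum_eq_partialSum x hjk hj1 hj2] at h2
    rw [TimePartition.qSum_eq_partialSum x hjk le_rfl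
      (TimePartition.t_lt_t (Nat.lt_succ_self j) hjk)] at h5
    linarith
  obtain ⟨j, hj⟩ := hpoint.choice
  have h1 : Tendsto (fun n => (π n).t (j n)) atTop (𝓝 t) :=
    (hlam t).congr' (hj.mono fun n h => h.2.symm)
  have h2 := hπ.tendsto_t_succ (hj.mono fun n h => h.1) h1
  have hS1 : Tendsto (fun n => (π n).partialSum x (j n + 1)) atTop (𝓝 (q t)) := by
    refine (hq t le_rfl).congr' ?_
    filter_upwards [hj] with n hn
    rw [← hn.2, TimePartition.qSum_eq_partialSum x hn.1 le_rfl
      (TimePartition.t_lt_t (Nat.lt_succ_self _) hn.1)]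
  have hS0 : Tendsto (fun n => (π n).partialSum x (j n)) atTop (𝓝 (q t - q.jump t)) := by
    refine tendsto_order.mpr ⟨fun c hc => ?_, fun c hc => ?_⟩
    · obtain ⟨s, hst, hs⟩ := exists_lt_of_tendsto_left ht hl hc
      filter_upwards [hj, (hq s hst.le).eventually_const_lt hs] with n hn hn'
      exact hn'.trans_le (TimePartition.qSum_le_partialSum x hn.1.le
        (hn.2 ▸ (lam n).strictMono hst))
    · filter_upwards [hj, hbelow c hc] with n hn hn'
      rcases hjn : j n with _ | i
      · have h0 : lam n t = 0 := by rw [← hn.2, hjn, TimePartition.t_zero]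
        have h3 : (0 : ℝ≥0) < lam n t :=
          lt_of_le_of_lt zero_le ((lam n).strictMono ht)
        exact absurd h0 h3.ne'
      · rw [hjn] at hn
        exact (TimePartition.partialSum_le_qSum x ((Nat.lt_succ_self i).trans hn.1) le_rfl).trans_lt
          (hn' _ (hn.2 ▸ TimePartition.t_lt_t (Nat.lt_succ_self i) hn.1.le))
  have hinc : Tendsto (fun n => (x ((π n).t (j n + 1)) - x ((π n).t (j n))) ^ 2) atTop
      (𝓝 (q.jump t)) := by
    have := hS1.sub hS0
    rw [sub_sub_cancel] at this
    refine this.congr fun n => ?_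
    rw [TimePartition.partialSum_succ]
    ring
  have hE := (x.tendsto_increment_sub_step h1 h2).pow 2
  rw [zero_pow two_ne_zero] at hE
  -- Over intervals that shrink to `t` without straddling it the increments of `x` vanish, whereas
  -- here their squares tend to `q.jump t > 0`.
  have hstr : ∀ᶠ n in atTop, (π n).t (j n) < t ∧ t ≤ (π n).t (j n + 1) := by
    filter_upwards [hj, hinc.eventually_const_lt (half_lt_self hD),
      hE.eventually_lt_const (half_pos hD)] with n hn g1 g2
    have hlt := TimePartition.t_lt_t (Nat.lt_succ_self (j n)) hn.1
    by_contra hcon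
    rcases lt_or_ge ((π n).t (j n)) t with h | h
    · have h' : ¬ t ≤ (π n).t (j n + 1) := fun h' => hcon ⟨h, h'⟩
      rw [if_neg h', if_neg (not_le.mpr h), sub_self, sub_zero] at g2
      linarith
    · rw [if_pos (h.trans hlt.le), if_pos h, sub_self, sub_zero] at g2
      linarith
  exact tendsto_nhds_unique hinc ((x.tendsto_increment_jump h1 h2 hstr).pow 2)

theorem IsLimitJ1.isLimitQ_and_hasLebesgueDecomposition (hπ : IsPartitionSequence π)
    (h : IsLimitJ1 π x q) : IsLimitQ π x q ∧ HasLebesgueDecomposition x q := by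
  obtain ⟨lam, hlam, hunif⟩ := h
  have hlam : ∀ s, Tendsto (fun n => lam n s) atTop (𝓝 s) := fun s => hlam.tendsto_at s
  have hunif : ∀ N : ℝ≥0, TendstoUniformlyOn (fun n s => (π n).qSum x (lam n s)) q atTop
    (Set.Iic N) := hunif
  have hq : ∀ s, Tendsto (fun n => (π n).qSum x (lam n s)) atTop (𝓝 (q s)) :=
    fun s => (hunif s).tendsto_at (Set.mem_Iic.mpr le_rfl)
  have hm : Monotone q := fun s t hst => le_of_tendsto_of_tendsto' (hq s) (hq t) fun n =>
    (π n).qSum_mono x ((lam n).monotone hst)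
  have hlam0 : ∀ n, lam n 0 = 0 := fun n => (lam n).map_bot
  have hq0 : q 0 = 0 := by
    have h0 := hq 0
    simp only [hlam0] at h0
    exact tendsto_nhds_unique h0 (tendsto_qSum_zero hπ x)
  have hr : ∀ t, ContinuousWithinAt q (Set.Ici t) t := fun t => (q.isCadlag t).1
  have hjump : ∀ t, q.jump t = x.jump t ^ 2 := by
    intro t
    rcases eq_or_ne t 0 with rfl | ht
    · simp [CadlagPath.jump_zero]
    have ht := pos_iff_ne_zero.mpr ht
    have hle := sq_jump_le_jump hπ hlam hq ht
    rcases ((sq_nonneg _).trans hle).eq_or_lt with h0 | h0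
    · exact le_antisymm (h0 ▸ sq_nonneg _) hle
    · exact jump_eq_sq_jump_of_pos hπ hlam (hunif t) hm ht h0
  have hl : ∀ t, Tendsto q (𝓝[<] t) (𝓝 (q t - x.jump t ^ 2)) := fun t =>
    hjump t ▸ q.tendsto_left t
  refine ⟨fun t => ?_, (hasLebesgueDecomposition_iff x q).mpr ⟨hm, hq0, hr, hl⟩⟩
  rcases eq_or_ne t 0 with rfl | ht
  · rw [hq0]
    exact tendsto_qSum_zero hπ x
  have ht := pos_iff_ne_zero.mpr ht
  refine tendsto_order.mpr ⟨fun a ha => ?_, fun b hb => ?_⟩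
  · obtain ⟨j, hj, -⟩ := hπ.exists_straddle_Ioc ht
    rw [← sub_add_cancel (q t) (x.jump t ^ 2)] at ha
    have hlow : ∀ a < q t - x.jump t ^ 2, ∃ r < t, ∀ᶠ n in atTop, a < (π n).qSum x r := by
      intro a ha
      obtain ⟨s, hst, hs⟩ := exists_lt_of_tendsto_left ht (hl t) ha
      obtain ⟨r, hsr, hrt⟩ := exists_between hst
      refine ⟨r, hrt, ?_⟩
      filter_upwards [(hq s).eventually_const_lt hs, (hlam s).eventually_lt_const hsr] with n h1 h2
      exact h1.trans_le ((π n).qSum_mono x h2.le)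
    filter_upwards [hj, eventually_lt_partialSum hπ hlow hj ha] with n h1 h2
    exact h2.trans_le (TimePartition.partialSum_le_qSum x h1.1 h1.2.1.le)
  · obtain ⟨s, hts, hs⟩ := exists_gt_of_rightCont (hr t) hb
    filter_upwards [(hq s).eventually_lt_const hs, (hlam s).eventually_const_lt hts] with n h1 h2
    exact ((π n).qSum_mono x h2.le).trans_lt h1

end PathwiseQV

/-! ### From pointwise convergence to `J₁` convergence: constructing time changes. -/

namespace PathwiseQV

/-- The tent function of height one centred at `u` with half-width `γ`. -/
noncomputable def tent (γ : ℝ) (u s : ℝ≥0) : ℝ := max (1 - |(s : ℝ) - u| / γ) 0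

theorem tent_self (γ : ℝ) (u : ℝ≥0) : tent γ u u = 1 := by simp [tent]

theorem tent_nonneg (γ : ℝ) (u s : ℝ≥0) : 0 ≤ tent γ u s := le_max_right _ _

theorem tent_le_one {γ : ℝ} (hγ : 0 < γ) (u s : ℝ≥0) : tent γ u s ≤ 1 :=
  max_le (sub_le_self _ (by positivity)) zero_le_one

theorem tent_eq_zero {γ : ℝ} (hγ : 0 < γ) {u s : ℝ≥0} (h : γ ≤ |(s : ℝ) - u|) :
    tent γ u s = 0 :=
  max_eq_right (sub_nonpos.mpr ((one_le_div hγ).mpr h))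

theorem abs_tent_sub_le {γ : ℝ} (hγ : 0 < γ) (u s r : ℝ≥0) :
    |tent γ u s - tent γ u r| ≤ |(s : ℝ) - r| / γ := by
  refine (abs_max_sub_max_le_abs (1 - |(s : ℝ) - u| / γ) (1 - |(r : ℝ) - u| / γ) 0).trans ?_
  rw [show 1 - |(s : ℝ) - u| / γ - (1 - |(r : ℝ) - u| / γ) =
    (|(r : ℝ) - u| - |(s : ℝ) - u|) / γ by ring, abs_div, abs_of_pos hγ]
  refine div_le_div_of_nonneg_right ?_ hγ.le
  refine (abs_abs_sub_abs_le ((r : ℝ) - u) (s - u)).trans (le_of_eq ?_)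
  rw [sub_sub_sub_cancel_right, abs_sub_comm]

theorem continuous_tent (γ : ℝ) (u : ℝ≥0) : Continuous (tent γ u) := by
  unfold tent
  fun_prop

/-- A function `s ↦ s + g s` on `[0,∞)` with `g 0 = 0` and `g` contracting is a time change. -/
theorem exists_orderIso_of_contracting {g : ℝ≥0 → ℝ} (hg : Continuous g) (h0 : g 0 = 0)
    (hlip : ∀ s r : ℝ≥0, |g s - g r| ≤ |(s : ℝ) - r| / 2) :
    ∃ lam : ℝ≥0 ≃o ℝ≥0, ∀ s, (lam s : ℝ) = s + g s := by
  have hmono : ∀ r s : ℝ≥0, r ≤ s → ((s : ℝ) - r) / 2 ≤ (s + g s) - (r + g r) := by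
    intro r s hrs
    have h1 := hlip s r
    rw [abs_of_nonneg (sub_nonneg.mpr (NNReal.coe_le_coe.mpr hrs)), abs_le] at h1
    linarith [h1.1]
  have hpos : ∀ s : ℝ≥0, (s : ℝ) / 2 ≤ s + g s := fun s => by
    simpa [h0] using hmono 0 s zero_le
  set f : ℝ≥0 → ℝ≥0 := fun s => Real.toNNReal (s + g s) with hf
  have hfc : ∀ s, (f s : ℝ) = s + g s := fun s =>
    Real.coe_toNNReal _ (le_trans (by positivity) (hpos s))
  have hfs : StrictMono f := by
    intro r s hrs
    rw [← NNReal.coe_lt_coe, hfc, hfc]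
    have := hmono r s hrs.le
    have h2 := NNReal.coe_lt_coe.mpr hrs
    linarith
  have hsurj : Function.Surjective f := by
    intro y
    -- `2 * y` works because `s + g s ≥ s / 2`.
    refine mem_range_of_exists_le_of_exists_ge (f := f) (by fun_prop) ⟨0, ?_⟩ ⟨2 * y, ?_⟩
    · rw [← NNReal.coe_le_coe, hfc, h0]
      simp
    · rw [← NNReal.coe_le_coe, hfc]
      refine le_trans (le_of_eq ?_) (hpos _)
      push_cast
      ring
  exact ⟨hfs.orderIsoOfSurjective f hsurj, hfc⟩

/-- Finitely many positive times can be displaced slightly by a time change that is uniformly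
close to the identity. -/
theorem exists_orderIso_displacing (U : Finset ℝ≥0) (hU : ∀ u ∈ U, 0 < u) {η : ℝ} (hη : 0 < η) :
    ∃ δ > 0, ∀ d : ℝ≥0 → ℝ, (∀ u ∈ U, |d u| ≤ δ) → ∃ lam : ℝ≥0 ≃o ℝ≥0,
      (∀ s, |(lam s : ℝ) - s| ≤ η) ∧ ∀ u ∈ U, (lam u : ℝ) = u + d u := by
  -- With this half-width each tent vanishes at `0` and at the other centres, so each `u` is
  -- displaced by `d u` exactly.
  obtain ⟨γ, ⟨hγ1, hγ2⟩, hγ⟩ : ∃ γ : ℝ, ((∀ u ∈ U, γ < u) ∧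
      ∀ u ∈ U, ∀ w ∈ U, u ≠ w → γ < |(u : ℝ) - w|) ∧ 0 < γ := by
    refine Eventually.exists (f := 𝓝[>] (0 : ℝ)) (.and (.and ?_ ?_) self_mem_nhdsWithin)
    · refine (Finset.eventually_all U).mpr fun u hu => ?_
      exact mem_nhdsWithin_of_mem_nhds (Iio_mem_nhds (NNReal.coe_pos.mpr (hU u hu)))
    · refine (Finset.eventually_all U).mpr fun u _ => (Finset.eventually_all U).mpr fun w _ => ?_
      by_cases huw : u = w
      · exact Eventually.of_forall fun _ h => absurd huw h
      · have : 0 < |(u : ℝ) - w| := abs_pos.mpr (sub_ne_zero.mpr fun h => huw (NNReal.coe_injective h))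
        filter_upwards [mem_nhdsWithin_of_mem_nhds (Iio_mem_nhds this)] with γ h _ using h
  have hc : (0 : ℝ) < U.card + 1 := by positivity
  -- Tents may overlap, so all `U.card` terms are added: `U.card * δ ≤ η` gives closeness to the
  -- identity, `U.card * δ ≤ γ / 2` the Lipschitz constant `1 / 2`. The `+ 1` allows empty `U`.
  refine ⟨min η (γ / 2) / (U.card + 1), by positivity, fun d hd => ?_⟩
  set δ := min η (γ / 2) / (U.card + 1) with hδ
  have hδ0 : 0 < δ := by positivity
  have hcδ : U.card * δ ≤ min η (γ / 2) := by
    have : (U.card + 1) * δ = min η (γ / 2) := by rw [hδ]; field_simp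
    linarith
  set g : ℝ≥0 → ℝ := fun s => ∑ u ∈ U, d u * tent γ u s with hg
  obtain ⟨lam, hlam⟩ := exists_orderIso_of_contracting (g := g)
    (continuous_finsetSum _ fun u _ => continuous_const.mul (continuous_tent γ u))
    (Finset.sum_eq_zero fun u hu => by
      rw [tent_eq_zero hγ, mul_zero]
      simpa using (hγ1 u hu).le)
    (fun s r => by
      rw [hg, ← Finset.sum_sub_distrib]
      refine (Finset.abs_sum_le_sum_abs _ _).trans ?_
      refine (Finset.sum_le_card_nsmul U _ (δ * (|(s : ℝ) - r| / γ)) fun u hu => ?_).trans ?_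
      · rw [← mul_sub, abs_mul]
        exact mul_le_mul (hd u hu) (abs_tent_sub_le hγ u s r) (abs_nonneg _) hδ0.le
      · rw [nsmul_eq_mul, ← mul_assoc]
        calc U.card * δ * (|(s : ℝ) - r| / γ) ≤ γ / 2 * (|(s : ℝ) - r| / γ) := by
              gcongr
              exact hcδ.trans (min_le_right _ _)
          _ = |(s : ℝ) - r| / 2 := by field_simp)
  refine ⟨lam, fun s => ?_, fun u hu => ?_⟩
  · rw [hlam, add_sub_cancel_left]
    refine (Finset.abs_sum_le_sum_abs _ _).trans ?_
    refine (Finset.sum_le_card_nsmul U _ δ fun u hu => ?_).trans ?_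
    · rw [abs_mul, abs_of_nonneg (tent_nonneg _ _ _)]
      exact (mul_le_of_le_one_right (abs_nonneg _) (tent_le_one hγ u s)).trans (hd u hu)
    · rw [nsmul_eq_mul]
      exact hcδ.trans (min_le_left _ _)
  · rw [hlam, hg]
    simp only
    rw [Finset.sum_eq_single u, tent_self, mul_one]
    · intro w hw hwu
      rw [tent_eq_zero hγ (hγ2 u hu w hw hwu.symm).le, mul_zero]
    · exact fun h => absurd hu h

/-- A right-continuous function with smaller left limits `l` has finitely many points between
which it oscillates little. -/
theorem exists_finset_small_oscillation {v l : ℝ≥0 → ℝ}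
    (hr : ∀ t, ContinuousWithinAt v (Set.Ici t) t) (hl : ∀ t, Tendsto v (𝓝[<] t) (𝓝 (l t)))
    (hlv : ∀ t, l t ≤ v t) {ε : ℝ} (hε : 0 < ε) (N : ℝ≥0) : ∃ U : Finset ℝ≥0,
      ∀ s ≤ N, ∃ u ∈ U, ∃ w ∈ U, u ≤ s ∧ s < w ∧ l w ≤ v u + ε := by
  suffices h : ∃ U : Finset ℝ≥0, ∀ s ∈ Set.Icc 0 N, ∃ u ∈ U, ∃ w ∈ U,
      u ≤ s ∧ s < w ∧ l w ≤ v u + ε by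
    obtain ⟨U, hU⟩ := h
    exact ⟨U, fun s hs => hU s ⟨zero_le, hs⟩⟩
  refine (isCompact_Icc_zero N).induction_on
    (p := fun S => ∃ U : Finset ℝ≥0, ∀ s ∈ S, ∃ u ∈ U, ∃ w ∈ U, u ≤ s ∧ s < w ∧ l w ≤ v u + ε)
    ⟨∅, by simp⟩ ?_ ?_ ?_
  · rintro S S' hS ⟨U, hU⟩
    exact ⟨U, fun s hs => hU s (hS hs)⟩
  · classical
    rintro S S' ⟨U, hU⟩ ⟨U', hU'⟩
    refine ⟨U ∪ U', fun s hs => ?_⟩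
    rcases hs with hs | hs
    · obtain ⟨u, hu, w, hw, h⟩ := hU s hs
      exact ⟨u, Finset.mem_union_left _ hu, w, Finset.mem_union_left _ hw, h⟩
    · obtain ⟨u, hu, w, hw, h⟩ := hU' s hs
      exact ⟨u, Finset.mem_union_right _ hu, w, Finset.mem_union_right _ hw, h⟩
  -- Near `t` the points `a < t < b` suffice: `v a` is close to `l t`, and `l b ≤ v b` is close to
  -- `v t`.
  · intro t _
    obtain ⟨b, htb, hb⟩ := exists_gt_of_rightCont (hr t) (lt_add_of_pos_right (v t) hε)
    have hb' : l b ≤ v t + ε := (hlv b).trans hb.le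
    rcases eq_or_ne t 0 with rfl | ht
    · refine ⟨Set.Iio b, mem_nhdsWithin_of_mem_nhds (Iio_mem_nhds htb), {0, b}, fun s hs => ?_⟩
      exact ⟨0, by simp, b, by simp, zero_le, hs, hb'⟩
    · obtain ⟨a, hat, ha⟩ := exists_lt_of_tendsto_left (pos_iff_ne_zero.mpr ht) (hl t)
        (sub_lt_self (l t) hε)
      refine ⟨Set.Ioo a b, mem_nhdsWithin_of_mem_nhds (Ioo_mem_nhds hat htb), {a, t, b},
        fun s hs => ?_⟩
      rcases lt_or_ge s t with h | h
      · exact ⟨a, by simp, t, by simp, hs.1.le, h, by linarith⟩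
      · exact ⟨t, by simp, b, by simp, h, hs.2, hb'⟩

variable {π : ℕ → TimePartition} {x q : CadlagPath} {v : ℝ≥0 → ℝ}

/-- Every time `u` is approached by partition points at which the sums `q` make the jump that
the limit makes at `u`. -/
theorem exists_seq_matching_jump (hπ : IsPartitionSequence π) (hq : IsLimitQ π x v)
    (hv : HasLebesgueDecomposition x v) (u : ℝ≥0) : ∃ p : ℕ → ℝ≥0,
      Tendsto p atTop (𝓝 u) ∧ (u = 0 → ∀ n, p n = 0) ∧ ∀ ε > 0, ∀ᶠ n in atTop,
        v u - ε < (π n).qSum x (p n) ∧ ∀ r < p n, (π n).qSum x r < v u - x.jump u ^ 2 + ε := by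
  obtain ⟨hm, hv0, hr, hl⟩ := (hasLebesgueDecomposition_iff x v).mp hv
  rcases eq_or_ne u 0 with rfl | hu
  · refine ⟨fun _ => 0, tendsto_const_nhds, fun _ _ => rfl, fun ε hε => ?_⟩
    filter_upwards [(hq 0).eventually_const_lt (sub_lt_self _ hε)] with n hn
    exact ⟨hn, fun r hr => absurd hr not_lt_zero⟩
  have hu' := pos_iff_ne_zero.mpr hu
  obtain ⟨j, hj, h1, h2⟩ := hπ.exists_straddle_Ioc hu'
  -- The left end of the straddling interval is where `q_n` picks up the increment across `u`.
  refine ⟨fun n => (π n).t (j n), h1, fun h => absurd h hu, fun ε hε => ?_⟩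
  have hinc := (x.tendsto_increment_jump h1 h2 (hj.mono fun n h => h.2)).pow 2
  have hlow : ∀ a < v u - x.jump u ^ 2, ∃ r < u, ∀ᶠ n in atTop, a < (π n).qSum x r := by
    intro a ha
    obtain ⟨r, hru, hr⟩ := exists_lt_of_tendsto_left hu' (hl u) ha
    exact ⟨r, hru, (hq r).eventually_const_lt hr⟩
  filter_upwards [hj, eventually_lt_partialSum hπ hlow hj (a := v u - ε) (by linarith),
    (hq u).eventually_lt_const (show v u < v u + ε / 2 by linarith),
    hinc.eventually_const_lt (show x.jump u ^ 2 - ε / 2 < x.jump u ^ 2 by linarith)]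
    with n g1 g2 g3 g4
  refine ⟨g2.trans_le (TimePartition.partialSum_le_qSum x g1.1 le_rfl), fun r hr => ?_⟩
  have g5 := TimePartition.qSum_le_partialSum x g1.1.le hr
  have g6 := TimePartition.partialSum_le_qSum x g1.1 g1.2.1.le
  rw [TimePartition.partialSum_succ] at g6
  linarith

/-- The time change sends each `u` in the finite set `U` to its matching point. For `u ≤ s < w`,
monotonicity puts `q_n (lam s)` between `v u - ε / 2` and `v(w-) + ε / 2`, and `v s` between `v u`
and `v(w-) ≤ v u + ε / 2`. -/
theorem eventually_exists_timeChange (hπ : IsPartitionSequence π) (hq : IsLimitQ π x v)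
    (hv : HasLebesgueDecomposition x v) {ε : ℝ} (hε : 0 < ε) (N : ℝ≥0) :
    ∀ᶠ n in atTop, ∃ lam : ℝ≥0 ≃o ℝ≥0, (∀ s, |(lam s : ℝ) - s| ≤ ε) ∧
      ∀ s ≤ N, |(π n).qSum x (lam s) - v s| ≤ ε := by
  obtain ⟨hm, hv0, hr, hl⟩ := (hasLebesgueDecomposition_iff x v).mp hv
  obtain ⟨U, hU⟩ := exists_finset_small_oscillation hr hl
    (fun t => sub_le_self _ (sq_nonneg _)) (half_pos hε) N
  choose p hp hp0 hpq using exists_seq_matching_jump hπ hq hv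
  obtain ⟨δ, hδ, hlam⟩ := exists_orderIso_displacing (U.erase 0)
    (fun u hu => pos_iff_ne_zero.mpr (Finset.ne_of_mem_erase hu)) hε
  have h1 : ∀ᶠ n in atTop, ∀ u ∈ U, v u - ε / 2 < (π n).qSum x (p u n) ∧
      ∀ r < p u n, (π n).qSum x r < v u - x.jump u ^ 2 + ε / 2 :=
    (Finset.eventually_all U).mpr fun u _ => hpq u _ (half_pos hε)
  have h2 : ∀ᶠ n in atTop, ∀ u ∈ U, |(p u n : ℝ) - u| < δ :=
    (Finset.eventually_all U).mpr fun u _ => by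
      simpa only [NNReal.dist_eq] using Metric.tendsto_nhds.mp (hp u) δ hδ
  filter_upwards [h1, h2] with n hn1 hn2
  obtain ⟨lam, hlam1, hlam2⟩ := hlam (fun u => p u n - u) fun u hu =>
    (hn2 u (Finset.mem_of_mem_erase hu)).le
  have hlamU : ∀ u ∈ U, lam u = p u n := by
    intro u hu
    rcases eq_or_ne u 0 with rfl | hu0
    · rw [hp0 0 rfl n]
      exact lam.map_bot
    · have := hlam2 u (Finset.mem_erase.mpr ⟨hu0, hu⟩)
      rw [add_sub_cancel] at this
      exact NNReal.coe_injective this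
  refine ⟨lam, hlam1, fun s hs => ?_⟩
  obtain ⟨u, hu, w, hw, hus, hsw, huw⟩ := hU s hs
  have g1 := (hn1 u hu).1.trans_le
    ((π n).qSum_mono x ((hlamU u hu).ge.trans (lam.monotone hus)))
  have g2 := (hn1 w hw).2 (lam s) ((lam.strictMono hsw).trans_eq (hlamU w hw))
  have g3 := le_of_tendsto_left_of_monotone hm (hl w) hsw
  have g4 := hm hus
  rw [abs_le]
  constructor <;> linarith

theorem isLimitJ1_of_isLimitQ (hπ : IsPartitionSequence π) (hq : IsLimitQ π x q)
    (hv : HasLebesgueDecomposition x q) : IsLimitJ1 π x q := by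
  classical
  set P : ℕ → ℕ → (ℝ≥0 ≃o ℝ≥0) → Prop := fun m n lam =>
    (∀ s, |(lam s : ℝ) - s| ≤ 1 / ((m : ℝ) + 1)) ∧
      ∀ s ≤ (m : ℝ≥0), |(π n).qSum x (lam s) - q s| ≤ 1 / ((m : ℝ) + 1) with hP
  have hev : ∀ m, ∀ᶠ n in atTop, ∃ lam, P m n lam := fun m =>
    eventually_exists_timeChange hπ hq hv Nat.one_div_pos_of_nat m
  -- Diagonal choice: the best precision level `m ≤ n` available at `n`. As `findGreatest` defaults
  -- to `0`, the level is known to be attained only once level `0` is, hence `hev 0` below.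
  set φ : ℕ → ℕ := fun n => Nat.findGreatest (fun m => ∃ lam, P m n lam) n with hφ
  have hφt : Tendsto φ atTop atTop := by
    refine tendsto_atTop.mpr fun m => ?_
    filter_upwards [hev m, eventually_ge_atTop m] with n h1 h2
    exact Nat.le_findGreatest h2 h1
  obtain ⟨lam, hlam⟩ : ∃ lam : ℕ → (ℝ≥0 ≃o ℝ≥0), ∀ᶠ n in atTop, P (φ n) n (lam n) := by
    refine Eventually.choice ?_
    filter_upwards [hev 0] with n hn
    exact Nat.findGreatest_spec (P := fun m => ∃ lam, P m n lam) (Nat.zero_le n) hn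
  have hsmall : ∀ ε > (0 : ℝ), ∀ᶠ n in atTop, 1 / ((φ n : ℝ) + 1) < ε := fun ε hε =>
    hφt.eventually (tendsto_one_div_add_atTop_nhds_zero_nat.eventually_lt_const hε)
  refine ⟨lam, Metric.tendstoUniformly_iff.mpr fun ε hε => ?_, fun N =>
    Metric.tendstoUniformlyOn_iff.mpr fun ε hε => ?_⟩
  · filter_upwards [hlam, hsmall ε hε] with n h1 h2 s
    rw [dist_comm, NNReal.dist_eq]
    exact (h1.1 s).trans_lt h2
  · obtain ⟨M, hM⟩ := exists_nat_ge N
    filter_upwards [hlam, hsmall ε hε, hφt.eventually_ge_atTop M] with n h1 h2 h3 s hs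
    rw [dist_comm, Real.dist_eq]
    exact (h1.2 s (le_trans hs (hM.trans (by exact_mod_cast h3)))).trans_lt h2

theorem isLimitJ1_iff (hπ : IsPartitionSequence π) :
    IsLimitJ1 π x q ↔ IsLimitQ π x q ∧ HasLebesgueDecomposition x q :=
  ⟨fun h => h.isLimitQ_and_hasLebesgueDecomposition hπ,
    fun h => isLimitJ1_of_isLimitQ hπ h.1 h.2⟩

theorem HasLebesgueDecomposition.isCadlag (hv : HasLebesgueDecomposition x v) : IsCadlag v := by
  obtain ⟨-, -, hr, hl⟩ := (hasLebesgueDecomposition_iff x v).mp hv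
  exact fun t => ⟨hr t, _, hl t⟩

theorem IsLimitQ.unique {v w : ℝ≥0 → ℝ} (hv : IsLimitQ π x v) (hw : IsLimitQ π x w) : w = v :=
  funext fun t => tendsto_nhds_unique (hw t) (hv t)

end PathwiseQV

/-! ### Assembly of the equivalences. -/

theorem theorem2p7 (π : ℕ → PathwiseQV.TimePartition) (hπ : PathwiseQV.IsPartitionSequence π) :
    -- the four classes of paths coincide
    (PathwiseQV.Q₀ π = PathwiseQV.Q₁ π ∧ PathwiseQV.Q₁ π = PathwiseQV.Q₂ π ∧
      PathwiseQV.Q₂ π = PathwiseQV.QJ1 π) ∧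
    -- on them all four limits exist, are unique, and are the same function
    (∀ x ∈ PathwiseQV.Q₀ π, ∃ v : PathwiseQV.CadlagPath,
      (∀ w : ℝ≥0 → ℝ, PathwiseQV.IsQuadraticVariation π x w ↔ w = v.toFun) ∧
      (∀ s : ℝ≥0 → ℝ, PathwiseQV.IsLimitS π x s ↔ s = v.toFun) ∧
      (∀ q : ℝ≥0 → ℝ, PathwiseQV.IsLimitQ π x q ↔ q = v.toFun) ∧
      (∀ q : PathwiseQV.CadlagPath, PathwiseQV.IsLimitJ1 π x q ↔ q = v)) ∧
    -- finite quadratic variation is equivalent to convergence of `q_n` in `J₁`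
    (∀ x : PathwiseQV.CadlagPath,
      (∃ v : ℝ≥0 → ℝ, PathwiseQV.IsQuadraticVariation π x v) ↔
        ∃ q : PathwiseQV.CadlagPath, PathwiseQV.IsLimitJ1 π x q) ∧
    -- if `q_n` converges in `J₁`, its limit is the quadratic variation
    (∀ x q : PathwiseQV.CadlagPath, PathwiseQV.IsLimitJ1 π x q →
      ∀ v : ℝ≥0 → ℝ, PathwiseQV.IsQuadraticVariation π x v ↔ v = q.toFun) := by
  -- The `J₁` limit must be an element of `𝒟`; the decomposition makes the pointwise limit càdlàg.
  have hJ : ∀ x : PathwiseQV.CadlagPath,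
      (∃ v : ℝ≥0 → ℝ, PathwiseQV.IsLimitQ π x v ∧ PathwiseQV.HasLebesgueDecomposition x v) ↔
        ∃ q : PathwiseQV.CadlagPath, PathwiseQV.IsLimitJ1 π x q := fun x =>
    ⟨fun ⟨v, h1, h2⟩ => ⟨⟨v, h2.isCadlag⟩, (PathwiseQV.isLimitJ1_iff hπ).mpr ⟨h1, h2⟩⟩,
      fun ⟨q, h⟩ => ⟨q, (PathwiseQV.isLimitJ1_iff hπ).mp h⟩⟩
  refine ⟨⟨?_, ?_, ?_⟩, ?_, ?_, ?_⟩
  · ext x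
    simp only [PathwiseQV.Q₀, PathwiseQV.Q₁, Set.mem_ofPred_eq,
      PathwiseQV.isQuadraticVariation_iff hπ, PathwiseQV.isLimitS_iff_isLimitQ hπ]
  · ext x
    simp only [PathwiseQV.Q₁, PathwiseQV.Q₂, Set.mem_ofPred_eq,
      PathwiseQV.isLimitS_iff_isLimitQ hπ]
  · ext x
    exact hJ x
  · rintro x ⟨v, hv⟩
    obtain ⟨hq, hd⟩ := (PathwiseQV.isQuadraticVariation_iff hπ).mp hv
    refine ⟨⟨v, hd.isCadlag⟩, fun w => ⟨fun h => ?_, ?_⟩, fun s => ⟨fun h => ?_, ?_⟩,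
      fun q => ⟨fun h => hq.unique h, ?_⟩, fun q => ⟨fun h => ?_, ?_⟩⟩
    · exact hq.unique ((PathwiseQV.isQuadraticVariation_iff hπ).mp h).1
    · rintro rfl
      exact hv
    · exact hq.unique ((PathwiseQV.isLimitS_iff_isLimitQ hπ x s).mp h)
    · rintro rfl
      exact (PathwiseQV.isLimitS_iff_isLimitQ hπ x _).mpr hq
    · rintro rfl
      exact hq
    · exact PathwiseQV.CadlagPath.ext (hq.unique ((PathwiseQV.isLimitJ1_iff hπ).mp h).1)
    · rintro rfl
      exact (PathwiseQV.isLimitJ1_iff hπ).mpr ⟨hq, hd⟩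
  · intro x
    simp only [← hJ, PathwiseQV.isQuadraticVariation_iff hπ]
  · intro x q h v
    have hq := (PathwiseQV.isLimitJ1_iff hπ).mp h
    rw [PathwiseQV.isQuadraticVariation_iff hπ]
    refine ⟨fun h' => hq.1.unique h'.1, ?_⟩
    rintro rfl
    exact hq
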